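/- Let $n,d\ge 0$ be integers. For $m\in\{n,d\}$ let $\mathfrak g_m=\mathfrak{gl}(m,\mathbb C)$, viewed as a real Lie algebra with inner product $\langle X,Y\rangle=\mathrm{Im}\,\mathrm{tr}(XY)$, let $\mathfrak k_m=\mathfrak u(m)$ be the skew-Hermitian matrices and $\mathfrak b_m$ the upper-triangular matrices with real diagonal, so that $\mathfrak g_m=\mathfrak k_m\oplus\mathfrak b_m$; write $X=X_{\mathfrak k}+X_{\mathfrak b}$ for the corresponding decomposition, and let $R_m X=X_{\mathfrak k}-X_{\mathfrak b}$ be the corresponding r-matrix, regarded also as an element of $\mathfrak g_m\otimes\mathfrak g_m$ by means of the inner product. For smooth $F:\mathrm{GL}(m,\mathbb C)\to\mathbb R$ define $D_gF,D'_gF\in\mathfrak g_m$ by $\frac{d}{dt}\big|_{0}F(e^{tX}ge^{tY})=\langle D_gF,X\rangle+\langle D'_gF,Y\rangle$ for all $X,Y\in\mathfrak g_m$; the Sklyanin bracket is $\{F,H\}=\langle DF,R_m(DH)\rangle-\langle D'F,R_m(D'H)\rangle$. For smooth $F:U(m)\to\mathbb R$ define $D_kF,D'_kF\in\mathfrak b_m$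 by $\frac{d}{dt}\big|_{0}F(e^{tX}ke^{tY})=\langle X,D_kF\rangle+\langle Y,D'_kF\rangle$ for all $X,Y\in\mathfrak k_m$; the Lu–Weinstein bracket is $\{F,H\}(k)=\mathrm{Im}\,\mathrm{tr}\big(D_kF\;k\,D'_kH\,k^{-1}\big)$. Let $M=\mathrm{Mat}_{n\times d}(\mathbb C)$, viewed as a real vector space, and identify $\xi\in M$ with the covector $v\mapsto\mathrm{Im}\,\mathrm{tr}(\xi^\dagger v)$. Let $R_M$ and $\rho_M$ be the bivector fields on $M$ which are the images of $R_n$ and $R_d$ under the infinitesimal actions $X\mapsto X_M(v)=Xv$ of $\mathfrak g_n$ and $A\mapsto A_M(v)=-vA$ of $\mathfrak g_d$, let $\Pi(\xi,\eta)=\mathrm{Im}\,\mathrm{tr}(\xi^\dagger\eta)$, and for $\lambda\in\mathbb R$ put $P_\lambda=R_M+\rho_M-2\lambda\Pi$. A Poisson Lie group is a Lie group with a Poisson bracket on its smooth functions for which multiplication is a Poisson map. An action of a Poisson Lie group $G$ on a Poisson space $M$ is a Poisson action if $\{F,H\}_M(g\cdot m)=\{F(\,\cdot\,m),H(\,\cdot\,m)\}_G(g)+\{F(g\,\cdot\,),H(g\,\cdot\,)\}_M(m)$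 for all smooth $F,H$ on $M$ and all $g\in G$, $m\in M$. Then, for every $\lambda\in\mathbb R$: 1. $P_\lambda$ is a Poisson tensor, and $\{F,H\}=\frac12P_\lambda(dF,dH)$ is a Poisson bracket on $C^\infty(M,\mathbb R)$. For linear functions $F(v)=\mathrm{Im}\,\mathrm{tr}(\xi^\dagger v)$, $H(v)=\mathrm{Im}\,\mathrm{tr}(\eta^\dagger v)$ it is given by $$\{F,H\}(v)=\mathrm{Im}\,\mathrm{tr}\big(v\xi^\dagger(v\eta^\dagger)_{\mathfrak k_n}\big)+\mathrm{Im}\,\mathrm{tr}\big(\xi^\dagger v(\eta^\dagger v)_{\mathfrak k_d}-\xi^\dagger v\eta^\dagger v-\lambda\xi^\dagger\eta\big).$$ 2. The Hamiltonian vector field $\mathcal X_F$ of such an $F$, characterised by $dH(\mathcal X_F)=\{H,F\}$ for all smooth $H$, is $\mathcal X_F(v)=(v\xi^\dagger)_{\mathfrak k_n}v+v(\xi^\dagger v)_{\mathfrak k_d}-v\xi^\dagger v-\lambda\xi$. 3. The actions $k\cdot v=kv$ of $U(n)$ and $k\cdot v=vk^{-1}$ of $U(d)$ on $M$ are Poisson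 actions when $M$ carries the bracket $\frac12P_\lambda$ and $U(n)$, $U(d)$ carry the Lu–Weinstein brackets; equivalently, when $M$ carries $P_\lambda$ and $U(n)$, $U(d)$ carry twice the Lu–Weinstein brackets. Moreover, for $\lambda=0$ the actions $g\cdot v=gv$ of $\mathrm{GL}(n,\mathbb C)$ and $h\cdot v=vh^{-1}$ of $\mathrm{GL}(d,\mathbb C)$ are Poisson actions when $M$ carries $P_0$ and the groups carry the Sklyanin brackets; equivalently, when $M$ carries $\frac12P_0$ and the groups carry one half of the Sklyanin brackets. -/

import Mathlib

open scoped Matrix ContDiff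

namespace RealZakrzewski

/-! ### Poisson brackets, Poisson Lie groups, Poisson actions -/

/-- `br` is a Poisson bracket on the algebra of functions `S` (here: smooth real-valued functions):
a real bilinear, antisymmetric biderivation satisfying the Jacobi identity.  Outside of `S` the
values of `br` are irrelevant. -/
structure IsPoissonBracket {X : Type*} (S : Set (X → ℝ))
    (br : (X → ℝ) → (X → ℝ) → (X → ℝ)) : Prop where
  mem : ∀ F ∈ S, ∀ H ∈ S, br F H ∈ S
  add_left : ∀ F₁ ∈ S, ∀ F₂ ∈ S, ∀ H ∈ S, br (F₁ + F₂) H = br F₁ H + br F₂ H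
  smul_left : ∀ (c : ℝ), ∀ F ∈ S, ∀ H ∈ S, br (c • F) H = c • br F H
  skew : ∀ F ∈ S, ∀ H ∈ S, br F H = -br H F
  leibniz : ∀ F₁ ∈ S, ∀ F₂ ∈ S, ∀ H ∈ S, br (F₁ * F₂) H = F₁ * br F₂ H + br F₁ H * F₂
  jacobi : ∀ F₁ ∈ S, ∀ F₂ ∈ S, ∀ F₃ ∈ S,
    br F₁ (br F₂ F₃) + br F₂ (br F₃ F₁) + br F₃ (br F₁ F₂) = 0

/-- `G`, with smooth functions `S`, is a Poisson Lie group for the bracket `br`: multiplication is a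
Poisson map `G × G → G`. -/
structure IsPoissonLieGroup {G : Type*} [Group G] (S : Set (G → ℝ))
    (br : (G → ℝ) → (G → ℝ) → (G → ℝ)) : Prop where
  poisson : IsPoissonBracket S br
  smooth_left : ∀ F ∈ S, ∀ g₁ : G, (fun g => F (g₁ * g)) ∈ S
  smooth_right : ∀ F ∈ S, ∀ g₂ : G, (fun g => F (g * g₂)) ∈ S
  mult : ∀ F ∈ S, ∀ H ∈ S, ∀ g₁ g₂ : G,
    br (fun g => F (g * g₂)) (fun g => H (g * g₂)) g₁ +
      br (fun g => F (g₁ * g)) (fun g => H (g₁ * g)) g₂ = br F H (g₁ * g₂)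

/-- `act` is a (left) action of the Poisson Lie group `(G, SG, brG)` on the Poisson space
`(M, SM, brM)`, and it is a Poisson action: the action map `G × M → M` is Poisson. -/
structure IsPoissonAction {G M : Type*} [Group G]
    (SG : Set (G → ℝ)) (brG : (G → ℝ) → (G → ℝ) → (G → ℝ))
    (SM : Set (M → ℝ)) (brM : (M → ℝ) → (M → ℝ) → (M → ℝ)) (act : G → M → M) : Prop where
  poissonLie : IsPoissonLieGroup SG brG
  poisson : IsPoissonBracket SM brM
  one_act : ∀ m, act 1 m = m
  mul_act : ∀ g₁ g₂ m, act (g₁ * g₂) m = act g₁ (act g₂ m)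
  smooth_orbit : ∀ F ∈ SM, ∀ m, (fun g => F (act g m)) ∈ SG
  smooth_translate : ∀ F ∈ SM, ∀ g, (fun m => F (act g m)) ∈ SM
  map : ∀ F ∈ SM, ∀ H ∈ SM, ∀ g m,
    brM F H (act g m) =
      brG (fun g' => F (act g' m)) (fun g' => H (act g' m)) g +
        brM (fun m' => F (act g m')) (fun m' => H (act g m')) m

/-! ### Matrices -/

/-- The space `Mat_{n×d}(ℂ)`, treated as a real vector space. -/
abbrev Mat (n d : ℕ) : Type := Matrix (Fin n) (Fin d) ℂ

/-- The invariant inner product `⟨X, Y⟩ = Im tr (X Y)` on `gl(n, ℂ)`. -/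
def ip {n : ℕ} (X Y : Mat n n) : ℝ := (X * Y).trace.im

/-- `𝔨 = u(n)`, the skew-Hermitian matrices. -/
def frakK (n : ℕ) : Submodule ℝ (Mat n n) where
  carrier := {X | X + Xᴴ = 0}
  add_mem' := by
    intro X Y hX hY
    simp only [Set.mem_ofPred_eq, Matrix.conjTranspose_add] at *
    rw [add_add_add_comm, hX, hY, add_zero]
  zero_mem' := by simp
  smul_mem' := by
    intro c X hX
    simp only [Set.mem_ofPred_eq, Matrix.conjTranspose_smul, star_trivial] at *
    rw [← smul_add, hX, smul_zero]

/-- `𝔟`, the upper-triangular matrices with real entries on the diagonal. -/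
def frakB (n : ℕ) : Submodule ℝ (Mat n n) where
  carrier := {X | (∀ i j, j < i → X i j = 0) ∧ ∀ i, (X i i).im = 0}
  add_mem' := by
    rintro X Y ⟨hX, hX'⟩ ⟨hY, hY'⟩
    exact ⟨fun i j h => by simp [hX i j h, hY i j h], fun i => by simp [hX' i, hY' i]⟩
  zero_mem' := by simp
  smul_mem' := by
    rintro c X ⟨hX, hX'⟩
    exact ⟨fun i j h => by simp [hX i j h], fun i => by simp [hX' i]⟩

/-- `gl(n, ℂ) = 𝔨 ⊕ 𝔟` as real vector spaces. -/
theorem isCompl_frakK_frakB (n : ℕ) : IsCompl (frakK n) (frakB n) := by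
  rw [isCompl_iff, codisjoint_iff, Submodule.disjoint_def, Submodule.eq_top_iff']
  constructor
  · rintro X hX ⟨hB, hB'⟩
    have hX' : ∀ i j, X i j + star (X j i) = 0 := fun i j => by
      simpa using congrFun (congrFun (show X + Xᴴ = 0 from hX) i) j
    ext i j
    rcases lt_trichotomy i j with h | h | h
    · simpa [hB j i h] using hX' i j
    · subst h
      have h1 := congrArg Complex.re (hX' i i)
      simp at h1
      exact Complex.ext (by simp; linarith) (by simpa using hB' i)
    · simpa using hB i j h
  · intro X
    let K : Mat n n := Matrix.of fun i j =>
      if j < i then X i j else if i < j then -star (X j i) else ⟨0, (X i i).im⟩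
    refine Submodule.mem_sup.2 ⟨K, ?_, X - K, ⟨?_, ?_⟩, add_sub_cancel _ _⟩
    · change K + Kᴴ = 0
      ext i j
      rcases lt_trichotomy i j with h | h | h
      · simp [K, h, h.not_gt]
      · subst h
        apply Complex.ext <;> simp [K]
      · simp [K, h, h.not_gt]
    · intro i j h
      simp [K, h]
    · intro i
      simp [K]

/-- `X ↦ X_𝔨`, the projection onto `𝔨` along `𝔟`. -/
noncomputable def projK (n : ℕ) : Mat n n →ₗ[ℝ] Mat n n :=
  (frakK n).projection (frakB n) (isCompl_frakK_frakB n)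

/-- `X ↦ X_𝔟`, the projection onto `𝔟` along `𝔨`. -/
noncomputable def projB (n : ℕ) : Mat n n →ₗ[ℝ] Mat n n :=
  (frakB n).projection (frakK n) (isCompl_frakK_frakB n).symm

/-- The r-matrix `R = P_𝔨 - P_𝔟`, as an endomorphism of `gl(n, ℂ)`. -/
noncomputable def rMat (n : ℕ) : Mat n n →ₗ[ℝ] Mat n n := projK n - projB n

/-! ### Covectors -/

/-- The identification of covectors with matrices: `ξ` stands for `v ↦ Im tr (ξ† v)`. -/
noncomputable def cov (n d : ℕ) : Mat n d ≃ₗ[ℝ] Module.Dual ℝ (Mat n d) where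
  toFun ξ :=
    { toFun := fun v => (ξᴴ * v).trace.im
      map_add' := fun v w => by simp [Matrix.mul_add]
      map_smul' := fun c v => by simp }
  map_add' ξ η := by ext v; simp [Matrix.add_mul]
  map_smul' c ξ := by ext v; simp
  invFun α := Matrix.of fun i j =>
    ⟨α (Matrix.single i j Complex.I), -α (Matrix.single i j 1)⟩
  left_inv ξ := by
    ext i j
    simp [Matrix.trace_mul_single]
  right_inv α := by
    refine LinearMap.ext fun v => ?_
    have hv : v = ∑ i, ∑ j, ((v i j).re • Matrix.single i j (1 : ℂ) +
        (v i j).im • Matrix.single i j Complex.I) := by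
      conv_lhs => rw [Matrix.matrix_eq_sum_single v]
      refine Finset.sum_congr rfl fun i _ => Finset.sum_congr rfl fun j _ => ?_
      ext a b
      by_cases h : i = a ∧ j = b
      · obtain ⟨rfl, rfl⟩ := h
        simp
      · simp [h]
    conv_rhs => rw [hv]
    simp only [map_sum, map_add, map_smul, smul_eq_mul, LinearMap.coe_mk, AddHom.coe_mk,
      Matrix.trace, Matrix.diag, Matrix.mul_apply, Matrix.conjTranspose_apply, Complex.im_sum]
    rw [Finset.sum_comm]
    refine Finset.sum_congr rfl fun i _ => Finset.sum_congr rfl fun j _ => ?_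
    simp
    ring

/-- The identification `gl(n, ℂ)* ≅ gl(n, ℂ)` given by the inner product `Im tr (X Y)`. -/
noncomputable def sharp {n : ℕ} (φ : Module.Dual ℝ (Mat n n)) : Mat n n := ((cov n n).symm φ)ᴴ

theorem ip_sharp {n : ℕ} (φ : Module.Dual ℝ (Mat n n)) (X : Mat n n) : ip (sharp φ) X = φ X :=
  congrArg (fun ψ : Module.Dual ℝ (Mat n n) => ψ X) ((cov n n).apply_symm_apply φ)

/-! ### The bivectors on `M = Mat_{n×d}(ℂ)` -/

/-- A bivector field on `M`: at each point a form on the cotangent space. -/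
abbrev BivectorField (n d : ℕ) : Type :=
  Mat n d → Module.Dual ℝ (Mat n d) → Module.Dual ℝ (Mat n d) → ℝ

/-- The value at `v` of the vector field `X_M` generated by the action `g · v = g v`. -/
def infLeft {n d : ℕ} (v : Mat n d) : Mat n n →ₗ[ℝ] Mat n d where
  toFun X := X * v
  map_add' X Y := Matrix.add_mul X Y v
  map_smul' c X := by simp

/-- The value at `v` of the vector field `A_M` generated by the action `h · v = v h⁻¹`. -/
def infRight {n d : ℕ} (v : Mat n d) : Mat d d →ₗ[ℝ] Mat n d where
  toFun A := -(v * A)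
  map_add' A B := by rw [Matrix.mul_add, neg_add]
  map_smul' c A := by simp

/-- The image, under a linear map `a : gl(m, ℂ) → T_v M`, of the element of `gl(m, ℂ) ⊗ gl(m, ℂ)`
which corresponds to the endomorphism `r`, i.e. which, as a form on `gl(m, ℂ)* ≅ gl(m, ℂ)`, is
`(X, Y) ↦ ⟨X, r Y⟩`. -/
noncomputable def pushTensor {m n d : ℕ} (r : Mat m m →ₗ[ℝ] Mat m m) (a : Mat m m →ₗ[ℝ] Mat n d)
    (α β : Module.Dual ℝ (Mat n d)) : ℝ :=
  ip (sharp (α ∘ₗ a)) (r (sharp (β ∘ₗ a)))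

/-- `R_M`, from the r-matrix of `gl(n, ℂ)` and the left action. -/
noncomputable def bivR (n d : ℕ) : BivectorField n d :=
  fun v => pushTensor (rMat n) (infLeft v)

/-- `ρ_M`, from the r-matrix of `gl(d, ℂ)` and the right action. -/
noncomputable def bivRho (n d : ℕ) : BivectorField n d :=
  fun v => pushTensor (rMat d) (infRight v)

/-- The constant bivector `Π(ξ, η) = Im tr (ξ† η)`. -/
noncomputable def bivPi (n d : ℕ) : BivectorField n d :=
  fun _ α β => (((cov n d).symm α)ᴴ * (cov n d).symm β).trace.im

/-- `P_λ = R_M + ρ_M - 2 λ Π`. -/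
noncomputable def bivP (n d : ℕ) (lam : ℝ) : BivectorField n d :=
  bivR n d + bivRho n d - (2 * lam) • bivPi n d

/-! ### Smooth functions and brackets on `M` (all norms on `M` give the same notions) -/

attribute [local instance] Matrix.linftyOpNormedAddCommGroup Matrix.linftyOpNormedSpace

/-- Smooth real-valued functions on `Mat_{n×d}(ℂ)`. -/
def smoothMat (n d : ℕ) : Set (Mat n d → ℝ) := {F | ContDiff ℝ ∞ F}

/-- The bracket `{F, H}(v) = P(v)(dF, dH)` of a bivector field. -/
noncomputable def bivBracket {n d : ℕ} (P : BivectorField n d) (F H : Mat n d → ℝ) :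
    Mat n d → ℝ :=
  fun v => P v (fderiv ℝ F v : Mat n d →ₗ[ℝ] ℝ) (fderiv ℝ H v : Mat n d →ₗ[ℝ] ℝ)

/-- `P` is a Poisson tensor. -/
def IsPoissonTensor {n d : ℕ} (P : BivectorField n d) : Prop :=
  IsPoissonBracket (smoothMat n d) (bivBracket P)

/-- The bracket on `M` given by one half of `P_λ`. -/
noncomputable def bracketM (n d : ℕ) (lam : ℝ) : (Mat n d → ℝ) → (Mat n d → ℝ) → (Mat n d → ℝ) :=
  bivBracket ((1 / 2 : ℝ) • bivP n d lam)

/-- `V` is the Hamiltonian vector field of `F`: `V` acts on functions as `H ↦ {H, F}`. -/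
def IsHamiltonianVectorField {n d : ℕ}
    (br : (Mat n d → ℝ) → (Mat n d → ℝ) → (Mat n d → ℝ)) (F : Mat n d → ℝ)
    (V : Mat n d → Mat n d) : Prop :=
  ∀ H ∈ smoothMat n d, ∀ v, fderiv ℝ H v (V v) = br H F v

/-! ### The groups -/

/-- Smooth real-valued functions on a group embedded in `Mat_{n×n}(ℂ)` as a submanifold: those which
are locally restrictions of smooth functions on open subsets of the matrix space. -/
def smoothGroup {G : Type*} {n : ℕ} (ι : G → Mat n n) : Set (G → ℝ) :=
  {F | ∀ g : G, ∃ (U : Set (Mat n n)) (f : Mat n n → ℝ), IsOpen U ∧ ι g ∈ U ∧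
    ContDiffOn ℝ ∞ f U ∧ ∀ g', ι g' ∈ U → F g' = f (ι g')}

/-- The group `G_n = GL(n, ℂ)`. -/
abbrev GLn (n : ℕ) : Type := Matrix.GeneralLinearGroup (Fin n) ℂ

/-- The group `K_n = U(n)`. -/
abbrev Un (n : ℕ) : Type := Matrix.unitaryGroup (Fin n) ℂ

/-- `C^∞(GL(n, ℂ), ℝ)`. -/
def smoothGL (n : ℕ) : Set (GLn n → ℝ) := smoothGroup (fun g : GLn n => (g : Mat n n))

/-- `C^∞(U(n), ℝ)`. -/
def smoothU (n : ℕ) : Set (Un n → ℝ) := smoothGroup (fun k : Un n => (k : Mat n n))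

/-- The matrix exponential `gl(n, ℂ) → GL(n, ℂ)`. -/
noncomputable def expGL {n : ℕ} (X : Mat n n) : GLn n := (Matrix.isUnit_exp X).unit

/-- The matrix exponential `u(n) → U(n)`. -/
noncomputable def expU {n : ℕ} (X : frakK n) : Un n :=
  ⟨NormedSpace.exp (X : Mat n n), by
    have hX : (X : Mat n n)ᴴ = -(X : Mat n n) :=
      eq_neg_of_add_eq_zero_right (show (X : Mat n n) + (X : Mat n n)ᴴ = 0 from X.2)
    rw [Matrix.mem_unitaryGroup_iff, Matrix.star_eq_conjTranspose, ← Matrix.exp_conjTranspose, hX,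
      ← Matrix.exp_add_of_commute _ _ (Commute.neg_right (Commute.refl (X : Mat n n))), add_neg_cancel,
      NormedSpace.exp_zero]⟩

/-- `D = D_g F`, the left derivative of `F` at `g ∈ GL(n, ℂ)`. -/
def IsLeftDerivGL {n : ℕ} (F : GLn n → ℝ) (g : GLn n) (D : Mat n n) : Prop :=
  ∀ X : Mat n n, HasDerivAt (fun t : ℝ => F (expGL (t • X) * g)) (ip D X) 0

/-- `D = D'_g F`, the right derivative of `F` at `g ∈ GL(n, ℂ)`. -/
def IsRightDerivGL {n : ℕ} (F : GLn n → ℝ) (g : GLn n) (D : Mat n n) : Prop :=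
  ∀ X : Mat n n, HasDerivAt (fun t : ℝ => F (g * expGL (t • X))) (ip D X) 0

/-- `D = D_k F`, the left derivative of `F` at `k ∈ U(n)`, as an element of `𝔨* ≅ 𝔟`. -/
def IsLeftDerivU {n : ℕ} (F : Un n → ℝ) (k : Un n) (D : Mat n n) : Prop :=
  D ∈ frakB n ∧ ∀ X : frakK n, HasDerivAt (fun t : ℝ => F (expU (t • X) * k)) (ip (X : Mat n n) D) 0

/-- `D = D'_k F`, the right derivative of `F` at `k ∈ U(n)`, as an element of `𝔨* ≅ 𝔟`. -/
def IsRightDerivU {n : ℕ} (F : Un n → ℝ) (k : Un n) (D : Mat n n) : Prop :=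
  D ∈ frakB n ∧ ∀ X : frakK n, HasDerivAt (fun t : ℝ => F (k * expU (t • X))) (ip (X : Mat n n) D) 0

/-- The matrix with the property `p` (for the properties above it is unique, and exists when the
function is smooth; otherwise an irrelevant value). -/
noncomputable def theMat {n : ℕ} (p : Mat n n → Prop) : Mat n n := Classical.epsilon p

/-- The Sklyanin bracket `{F, H} = ⟨DF, R(DH)⟩ - ⟨D'F, R(D'H)⟩` on `GL(n, ℂ)`. -/
noncomputable def sklyaninBracket (n : ℕ) (F H : GLn n → ℝ) : GLn n → ℝ := fun g =>
  ip (theMat (IsLeftDerivGL F g)) (rMat n (theMat (IsLeftDerivGL H g))) -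
    ip (theMat (IsRightDerivGL F g)) (rMat n (theMat (IsRightDerivGL H g)))

/-- The Lu–Weinstein bracket `{F, H}(k) = Im tr (D_k F · k · D'_k H · k⁻¹)` on `U(n)`. -/
noncomputable def luWeinsteinBracket (n : ℕ) (F H : Un n → ℝ) : Un n → ℝ := fun k =>
  ip (theMat (IsLeftDerivU F k))
    ((k : Mat n n) * theMat (IsRightDerivU H k) * ((k⁻¹ : Un n) : Mat n n))

/-! ### The actions on `M` -/

/-- `g · v = g v`, for `g ∈ GL(n, ℂ)`. -/
def actLeftGL (n d : ℕ) (g : GLn n) (v : Mat n d) : Mat n d := (g : Mat n n) * v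

/-- `h · v = v h⁻¹`, for `h ∈ GL(d, ℂ)`. -/
def actRightGL (n d : ℕ) (h : GLn d) (v : Mat n d) : Mat n d := v * ((h⁻¹ : GLn d) : Mat d d)

/-- `k · v = k v`, for `k ∈ U(n)`. -/
def actLeftU (n d : ℕ) (k : Un n) (v : Mat n d) : Mat n d := (k : Mat n n) * v

/-- `k · v = v k⁻¹`, for `k ∈ U(d)`. -/
def actRightU (n d : ℕ) (k : Un d) (v : Mat n d) : Mat n d := v * ((k⁻¹ : Un d) : Mat d d)

end RealZakrzewski

open RealZakrzewski

/-!
All brackets in the statement are restrictions of one family of bivectors on matrix spaces,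
`P_{ε,λ} = R_M + ε ρ_M - 2 λ Π` with `ε = ± 1`: the tensor `P_λ` is `ε = 1`, and the Sklyanin
bracket of `GL(n, ℂ)` is `ε = -1`, `λ = 0` on square matrices.  The Lu–Weinstein bracket of `U(n)`
is one half of the restriction of the Sklyanin bracket to `U(n)` (`isInducedBracket_luWeinstein`):
the derivatives along `𝔨` are the `𝔟`-components of the derivatives on `GL(n, ℂ)`, the left and the
right ones are conjugate, and `𝔨`, `𝔟` are isotropic.

*Jacobi identity.*  For a bivector on a vector space, second derivatives of the functions cancel by
their symmetry, so that the Jacobi identity is the pointwise vanishing of the Schouten bracket on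
constant covectors (`IsPoissonField.jacobi`).  It passes to every bracket which is computed through
local extensions of functions (`IsInducedBracket.isPoissonBracket`).  For `P_{ε,λ}` the Schouten
bracket is a sum of traces (`schouten_term_matField`):
* the purely left terms give, by the modified Yang–Baxter equation (`yangBaxter`) and up to sign,
  the invariant cubic form `Im tr ([X, Y] Z)`, which the purely right terms (with the factor
  `ε ^ 2 = 1`) cancel (`trace_cubic`);
* the mixed terms, linear in `ε`, cancel in the cyclic sum, as the two actions commute;
* the terms linear in `λ` cancel for `ε = 1`, because `ξ η† - η ξ†` is skew-Hermitian and `R` is the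
  identity on `𝔨` (`schouten_linear`).

*Poisson actions.*  The orbit maps and the translations intertwine the infinitesimal actions, whence
the multiplicativity of the bivectors (`matField_mul_left`, `matField_mul_right`).  Here `Π` is only
invariant under unitary matrices, which is why the groups `GL` require `λ = 0`.  The case of a group
acting on itself from the left is the Poisson Lie property.
-/

namespace RealZakrzewski

/-! ### Poisson brackets induced by a Poisson field on a vector space -/

section Field

open Module (Dual)

variable {E F : Type*} [NormedAddCommGroup E] [NormedSpace ℝ E] [NormedAddCommGroup F]
  [NormedSpace ℝ F]

/-- A Poisson tensor on `E`, written as its sharp map: `T v β` is the vector `w` with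
`α w = P v α β` for all covectors `α`.  The last condition is the vanishing of the Schouten bracket
of `P` with itself, evaluated on constant covectors. -/
structure IsPoissonField (T : E → Dual ℝ E →ₗ[ℝ] E) : Prop where
  contDiff : ∀ α, ContDiff ℝ ∞ fun v => T v α
  skew : ∀ (v : E) (α β : Dual ℝ E), α (T v β) = -β (T v α)
  schouten : ∀ (v : E) (α β γ : Dual ℝ E), α (fderiv ℝ (fun w => T w γ) v (T v β)) +
    β (fderiv ℝ (fun w => T w α) v (T v γ)) + γ (fderiv ℝ (fun w => T w β) v (T v α)) = 0

theorem IsPoissonField.const_smul {T : E → Dual ℝ E →ₗ[ℝ] E} (hT : IsPoissonField T) (c : ℝ) :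
    IsPoissonField fun v => c • T v where
  contDiff α := (hT.contDiff α).const_smul c
  skew v α β := by simp [hT.skew v α β]
  schouten v α β γ := by
    have h : ∀ γ x, fderiv ℝ (fun w => c • T w γ) v x = c • fderiv ℝ (fun w => T w γ) v x := by
      intro γ x
      have := ((((hT.contDiff γ).differentiable (by simp)) v).hasFDerivAt.const_smul c).fderiv
      exact congrArg (fun L : E →L[ℝ] E => L x) this
    simp only [LinearMap.smul_apply, h, map_smul, smul_eq_mul]
    linear_combination c * c * hT.schouten v α β γ

/-- The bracket `{f, h} = df (T dh)`. -/
noncomputable def fieldBracket (T : E → Dual ℝ E →ₗ[ℝ] E) (f h : E → ℝ) : E → ℝ :=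
  fun v => fderiv ℝ f v (T v (fderiv ℝ h v : E →ₗ[ℝ] ℝ))

/-- Functions on `X` which are locally restrictions, along `ι`, of smooth functions on open
subsets of `E`. -/
def locallySmooth {X : Type*} (ι : X → E) : Set (X → ℝ) :=
  {F | ∀ x, ∃ (U : Set E) (f : E → ℝ), IsOpen U ∧ ι x ∈ U ∧ ContDiffOn ℝ ∞ f U ∧
    ∀ y, ι y ∈ U → F y = f (ι y)}

/-- `br` is the restriction along `ι` of the bracket of `T`: it is computed by means of arbitrary
local extensions of the functions. -/
def IsInducedBracket {X : Type*} (ι : X → E) (T : E → Dual ℝ E →ₗ[ℝ] E)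
    (br : (X → ℝ) → (X → ℝ) → (X → ℝ)) : Prop :=
  ∀ ⦃U : Set E⦄ ⦃f h : E → ℝ⦄ ⦃F H : X → ℝ⦄, IsOpen U → ContDiffOn ℝ ∞ f U →
    ContDiffOn ℝ ∞ h U → (∀ y, ι y ∈ U → F y = f (ι y)) → (∀ y, ι y ∈ U → H y = h (ι y)) →
    ∀ x, ι x ∈ U → br F H x = fieldBracket T f h (ι x)

theorem exists_common_extension {X : Type*} {ι : X → E} {F H : X → ℝ}
    (hF : F ∈ locallySmooth ι) (hH : H ∈ locallySmooth ι) (x : X) :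
    ∃ (U : Set E) (f h : E → ℝ), IsOpen U ∧ ι x ∈ U ∧ ContDiffOn ℝ ∞ f U ∧ ContDiffOn ℝ ∞ h U ∧
      (∀ y, ι y ∈ U → F y = f (ι y)) ∧ ∀ y, ι y ∈ U → H y = h (ι y) := by
  obtain ⟨U, f, hU, hx, hf, hFf⟩ := hF x
  obtain ⟨V, h, hV, hx', hh, hHh⟩ := hH x
  exact ⟨U ∩ V, f, h, hU.inter hV, ⟨hx, hx'⟩, hf.mono Set.inter_subset_left,
    hh.mono Set.inter_subset_right, fun y hy => hFf y hy.1, fun y hy => hHh y hy.2⟩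

variable [FiniteDimensional ℝ E]

/-- `T v`, as a continuous linear map on the continuous dual. -/
noncomputable def fieldCLM (T : E → Dual ℝ E →ₗ[ℝ] E) (v : E) : (E →L[ℝ] ℝ) →L[ℝ] E :=
  LinearMap.toContinuousLinearMap (T v ∘ₗ ContinuousLinearMap.coeLM ℝ)

theorem fieldCLM_apply (T : E → Dual ℝ E →ₗ[ℝ] E) (v : E) (α : E →L[ℝ] ℝ) :
    fieldCLM T v α = T v (α : E →ₗ[ℝ] ℝ) := rfl

theorem IsPoissonField.contDiff_fieldCLM {T : E → Dual ℝ E →ₗ[ℝ] E} (hT : IsPoissonField T) :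
    ContDiff ℝ ∞ (fieldCLM T) :=
  contDiff_clm_apply_iff.2 fun α => hT.contDiff α

theorem IsPoissonField.contDiffOn_fieldBracket {T : E → Dual ℝ E →ₗ[ℝ] E} (hT : IsPoissonField T)
    {U : Set E} (hU : IsOpen U) {f h : E → ℝ} (hf : ContDiffOn ℝ ∞ f U)
    (hh : ContDiffOn ℝ ∞ h U) : ContDiffOn ℝ ∞ (fieldBracket T f h) U :=
  (hf.fderiv_of_isOpen hU (by simp)).clm_apply
    (hT.contDiff_fieldCLM.contDiffOn.clm_apply (hh.fderiv_of_isOpen hU (by simp)))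

/-- By antisymmetry, the second derivative of `h` enters through the Hamiltonian vector of `f`,
and vice versa. -/
theorem IsPoissonField.fderiv_fieldBracket {T : E → Dual ℝ E →ₗ[ℝ] E} (hT : IsPoissonField T)
    {U : Set E} (hU : IsOpen U) {f h : E → ℝ} (hf : ContDiffOn ℝ ∞ f U)
    (hh : ContDiffOn ℝ ∞ h U) {v : E} (hv : v ∈ U) (x : E) :
    fderiv ℝ (fieldBracket T f h) v x =
      fderiv ℝ (fderiv ℝ f) v x (T v (fderiv ℝ h v : E →ₗ[ℝ] ℝ)) -
      fderiv ℝ (fderiv ℝ h) v x (T v (fderiv ℝ f v : E →ₗ[ℝ] ℝ)) +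
      fderiv ℝ f v (fderiv ℝ (fun w => T w (fderiv ℝ h v : E →ₗ[ℝ] ℝ)) v x) := by
  have hd : ∀ {f : E → ℝ}, ContDiffOn ℝ ∞ f U →
      HasFDerivAt (fderiv ℝ f) (fderiv ℝ (fderiv ℝ f) v) v := fun hf =>
    (((hf.fderiv_of_isOpen (m := ∞) hU (by simp)).contDiffAt (hU.mem_nhds hv)).differentiableAt
      (by simp)).hasFDerivAt
  have hT' : HasFDerivAt (fieldCLM T) (fderiv ℝ (fieldCLM T) v) v :=
    (hT.contDiff_fieldCLM.differentiable (by simp) v).hasFDerivAt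
  have key := (hd hf).clm_apply (hT'.clm_apply (hd hh))
  have hk : fderiv ℝ (fieldBracket T f h) v = _ := key.fderiv
  have hTx : fderiv ℝ (fun w => T w (fderiv ℝ h v : E →ₗ[ℝ] ℝ)) v x =
      fderiv ℝ (fieldCLM T) v x (fderiv ℝ h v) := by
    have := (hT'.clm_apply (hasFDerivAt_const (fderiv ℝ h v) v)).fderiv
    have h2 := congrArg (fun L : E →L[ℝ] E => L x) this
    simpa [fieldCLM_apply] using h2
  have hs := hT.skew v (fderiv ℝ f v : E →ₗ[ℝ] ℝ) (fderiv ℝ (fderiv ℝ h) v x : E →ₗ[ℝ] ℝ)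
  simp only [ContinuousLinearMap.coe_coe] at hs
  rw [hk, hTx]
  simp [fieldCLM_apply, hs]
  ring

/-- The terms with second derivatives cancel by the symmetry of the latter; the rest is the Schouten
bracket at the three differentials. -/
theorem IsPoissonField.jacobi {T : E → Dual ℝ E →ₗ[ℝ] E} (hT : IsPoissonField T)
    {U : Set E} (hU : IsOpen U) {f₁ f₂ f₃ : E → ℝ} (h₁ : ContDiffOn ℝ ∞ f₁ U)
    (h₂ : ContDiffOn ℝ ∞ f₂ U) (h₃ : ContDiffOn ℝ ∞ f₃ U) {v : E} (hv : v ∈ U) :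
    fieldBracket T f₁ (fieldBracket T f₂ f₃) v + fieldBracket T f₂ (fieldBracket T f₃ f₁) v +
      fieldBracket T f₃ (fieldBracket T f₁ f₂) v = 0 := by
  have hsymm : ∀ {f : E → ℝ}, ContDiffOn ℝ ∞ f U → ∀ x y,
      fderiv ℝ (fderiv ℝ f) v x y = fderiv ℝ (fderiv ℝ f) v y x := fun hf x y =>
    (hf.contDiffAt (hU.mem_nhds hv)).isSymmSndFDerivAt
      (by simpa using WithTop.coe_le_coe.2 (le_top (a := (2 : ℕ∞)))) x y
  have hs : ∀ f g : E → ℝ, fieldBracket T f g v =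
      -fderiv ℝ g v (T v (fderiv ℝ f v : E →ₗ[ℝ] ℝ)) := fun f g =>
    hT.skew v (fderiv ℝ f v : E →ₗ[ℝ] ℝ) (fderiv ℝ g v : E →ₗ[ℝ] ℝ)
  rw [hs, hs, hs, hT.fderiv_fieldBracket hU h₂ h₃ hv, hT.fderiv_fieldBracket hU h₃ h₁ hv,
    hT.fderiv_fieldBracket hU h₁ h₂ hv, hsymm h₁, hsymm h₂, hsymm h₃]
  have := hT.schouten v (fderiv ℝ f₂ v : E →ₗ[ℝ] ℝ) (fderiv ℝ f₁ v : E →ₗ[ℝ] ℝ)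
    (fderiv ℝ f₃ v : E →ₗ[ℝ] ℝ)
  simp only [ContinuousLinearMap.coe_coe] at this
  linear_combination -this

/-- The bracket of two functions is locally extended by the bracket of their extensions, hence the
Jacobi identity on `X` follows from the one on `E`. -/
theorem IsInducedBracket.isPoissonBracket {X : Type*} {ι : X → E} {T : E → Dual ℝ E →ₗ[ℝ] E}
    {br : (X → ℝ) → (X → ℝ) → (X → ℝ)} (hT : IsPoissonField T) (hbr : IsInducedBracket ι T br) :
    IsPoissonBracket (locallySmooth ι) br where
  mem F hF H hH x := by
    obtain ⟨U, f, h, hU, hx, hf, hh, hFf, hHh⟩ := exists_common_extension hF hH x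
    exact ⟨U, fieldBracket T f h, hU, hx, hT.contDiffOn_fieldBracket hU hf hh,
      fun y hy => hbr hU hf hh hFf hHh y hy⟩
  add_left F₁ h₁ F₂ h₂ H hH := by
    funext x
    obtain ⟨V, f₁, f₂, hV, hxV, hf₁, hf₂, e₁, e₂⟩ := exists_common_extension h₁ h₂ x
    obtain ⟨W, h, hW, hxW, hh, eH⟩ := hH x
    have hU := hV.inter hW
    replace hf₁ := hf₁.mono (Set.inter_subset_left (t := W))
    replace hf₂ := hf₂.mono (Set.inter_subset_left (t := W))
    replace hh := hh.mono (Set.inter_subset_right (s := V))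
    have hx : ι x ∈ V ∩ W := ⟨hxV, hxW⟩
    have d₁ := (hf₁.contDiffAt (hU.mem_nhds hx)).differentiableAt (by simp)
    have d₂ := (hf₂.contDiffAt (hU.mem_nhds hx)).differentiableAt (by simp)
    rw [Pi.add_apply, hbr hU hf₁ hh (fun y hy => e₁ y hy.1) (fun y hy => eH y hy.2) x hx,
      hbr hU hf₂ hh (fun y hy => e₂ y hy.1) (fun y hy => eH y hy.2) x hx,
      hbr hU (hf₁.add hf₂) hh (fun y hy => by rw [Pi.add_apply, e₁ y hy.1, e₂ y hy.1])
        (fun y hy => eH y hy.2) x hx]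
    simp [fieldBracket, fderiv_fun_add d₁ d₂]
  smul_left c F hF H hH := by
    funext x
    obtain ⟨U, f, h, hU, hx, hf, hh, hFf, hHh⟩ := exists_common_extension hF hH x
    have d := (hf.contDiffAt (hU.mem_nhds hx)).differentiableAt (by simp)
    rw [Pi.smul_apply, hbr hU hf hh hFf hHh x hx,
      hbr hU (hf.const_smul c) hh (fun y hy => by rw [Pi.smul_apply, hFf y hy]) hHh x hx]
    have hd : fderiv ℝ (c • f) (ι x) = c • fderiv ℝ f (ι x) := (d.hasFDerivAt.const_smul c).fderiv
    have he : (fun y => c • f y) = c • f := rfl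
    simp only [fieldBracket, he, hd]
    simp
  skew F hF H hH := by
    funext x
    obtain ⟨U, f, h, hU, hx, hf, hh, hFf, hHh⟩ := exists_common_extension hF hH x
    rw [Pi.neg_apply, hbr hU hf hh hFf hHh x hx, hbr hU hh hf hHh hFf x hx]
    exact hT.skew _ (fderiv ℝ f (ι x) : E →ₗ[ℝ] ℝ) (fderiv ℝ h (ι x) : E →ₗ[ℝ] ℝ)
  leibniz F₁ h₁ F₂ h₂ H hH := by
    funext x
    obtain ⟨V, f₁, f₂, hV, hxV, hf₁, hf₂, e₁, e₂⟩ := exists_common_extension h₁ h₂ x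
    obtain ⟨W, h, hW, hxW, hh, eH⟩ := hH x
    have hU := hV.inter hW
    replace hf₁ := hf₁.mono (Set.inter_subset_left (t := W))
    replace hf₂ := hf₂.mono (Set.inter_subset_left (t := W))
    replace hh := hh.mono (Set.inter_subset_right (s := V))
    have hx : ι x ∈ V ∩ W := ⟨hxV, hxW⟩
    have d₁ := (hf₁.contDiffAt (hU.mem_nhds hx)).differentiableAt (by simp)
    have d₂ := (hf₂.contDiffAt (hU.mem_nhds hx)).differentiableAt (by simp)
    rw [Pi.add_apply, Pi.mul_apply, Pi.mul_apply,
      hbr hU hf₁ hh (fun y hy => e₁ y hy.1) (fun y hy => eH y hy.2) x hx,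
      hbr hU hf₂ hh (fun y hy => e₂ y hy.1) (fun y hy => eH y hy.2) x hx,
      hbr hU (hf₁.mul hf₂) hh (fun y hy => by rw [Pi.mul_apply, e₁ y hy.1, e₂ y hy.1])
        (fun y hy => eH y hy.2) x hx, e₁ x hxV, e₂ x hxV]
    simp [fieldBracket, fderiv_fun_mul d₁ d₂]
    ring
  jacobi F₁ h₁ F₂ h₂ F₃ h₃ := by
    funext x
    obtain ⟨V, f₁, f₂, hV, hxV, hf₁, hf₂, e₁, e₂⟩ := exists_common_extension h₁ h₂ x
    obtain ⟨W, f₃, hW, hxW, hf₃, e₃⟩ := h₃ x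
    have hU := hV.inter hW
    replace hf₁ := hf₁.mono (Set.inter_subset_left (t := W))
    replace hf₂ := hf₂.mono (Set.inter_subset_left (t := W))
    replace hf₃ := hf₃.mono (Set.inter_subset_right (s := V))
    replace e₁ : ∀ y, ι y ∈ V ∩ W → F₁ y = f₁ (ι y) := fun y hy => e₁ y hy.1
    replace e₂ : ∀ y, ι y ∈ V ∩ W → F₂ y = f₂ (ι y) := fun y hy => e₂ y hy.1
    replace e₃ : ∀ y, ι y ∈ V ∩ W → F₃ y = f₃ (ι y) := fun y hy => e₃ y hy.2
    have hx : ι x ∈ V ∩ W := ⟨hxV, hxW⟩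
    have c₁ := hT.contDiffOn_fieldBracket hU hf₂ hf₃
    have c₂ := hT.contDiffOn_fieldBracket hU hf₃ hf₁
    have c₃ := hT.contDiffOn_fieldBracket hU hf₁ hf₂
    rw [Pi.add_apply, Pi.add_apply, Pi.zero_apply,
      hbr hU hf₁ c₁ e₁ (hbr hU hf₂ hf₃ e₂ e₃) x hx,
      hbr hU hf₂ c₂ e₂ (hbr hU hf₃ hf₁ e₃ e₁) x hx,
      hbr hU hf₃ c₃ e₃ (hbr hU hf₁ hf₂ e₁ e₂) x hx]
    exact hT.jacobi hU hf₁ hf₂ hf₃ hx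

theorem contDiff_quadratic [FiniteDimensional ℝ F] (B : E →ₗ[ℝ] E →ₗ[ℝ] F) (c : F) :
    ContDiff ℝ ∞ fun v => B v v + c :=
  (((B.toContinuousBilinearMap).contDiff.clm_apply contDiff_id).add contDiff_const :)

theorem fderiv_quadratic [FiniteDimensional ℝ F] (B : E →ₗ[ℝ] E →ₗ[ℝ] F) (c : F) (v x : E) :
    fderiv ℝ (fun v => B v v + c) v x = B v x + B x v := by
  have h := (((B.toContinuousBilinearMap).hasFDerivAt (x := v)).clm_apply
    (hasFDerivAt_id v)).add_const c
  have h' : fderiv ℝ (fun v => B v v + c) v = _ := h.fderiv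
  rw [h']
  simp

end Field

/-! ### Pulling back and restricting local extensions -/

section Pullback

variable {E F : Type*} [NormedAddCommGroup E] [NormedSpace ℝ E] [FiniteDimensional ℝ E]
  [NormedAddCommGroup F] [NormedSpace ℝ F]

theorem contDiffOn_comp_linearMap (φ : E →ₗ[ℝ] F) {U : Set F} {f : F → ℝ}
    (hf : ContDiffOn ℝ ∞ f U) : ContDiffOn ℝ ∞ (fun x => f (φ x)) (φ ⁻¹' U) :=
  hf.comp (LinearMap.toContinuousLinearMap φ).contDiff.contDiffOn fun _ h => h

theorem contDiff_comp_linearMap (φ : E →ₗ[ℝ] F) {f : F → ℝ} (hf : ContDiff ℝ ∞ f) :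
    ContDiff ℝ ∞ fun x => f (φ x) :=
  hf.comp (LinearMap.toContinuousLinearMap φ).contDiff

theorem isOpen_preimage_linearMap (φ : E →ₗ[ℝ] F) {U : Set F} (hU : IsOpen U) :
    IsOpen (φ ⁻¹' U) :=
  hU.preimage (LinearMap.toContinuousLinearMap φ).continuous

theorem fderiv_comp_linearMap (φ : E →ₗ[ℝ] F) {U : Set F} (hU : IsOpen U) {f : F → ℝ}
    (hf : ContDiffOn ℝ ∞ f U) {x : E} (hx : φ x ∈ U) :
    (fderiv ℝ (fun y => f (φ y)) x : E →ₗ[ℝ] ℝ) = (fderiv ℝ f (φ x) : F →ₗ[ℝ] ℝ) ∘ₗ φ := by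
  have hd := ((hf.contDiffAt (hU.mem_nhds hx)).differentiableAt (by simp)).hasFDerivAt
  have h := HasFDerivAt.comp x hd (LinearMap.toContinuousLinearMap φ).hasFDerivAt
  have h' : fderiv ℝ (fun y => f (φ y)) x = _ := h.fderiv
  rw [h']
  rfl

/-- Local extensions pull back along `x ↦ φ x⁻¹`, near a unit; the differential of the inversion at
`u` is `x ↦ -u⁻¹ x u⁻¹`. -/
theorem exists_comp_inverse {R : Type*} [NormedRing R] [NormedAlgebra ℝ R] [CompleteSpace R]
    [FiniteDimensional ℝ R] (φ : R →ₗ[ℝ] F) {U : Set F} (hU : IsOpen U) {f : F → ℝ}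
    (hf : ContDiffOn ℝ ∞ f U) (u : Rˣ) (hu : φ ↑u⁻¹ ∈ U) :
    ∃ V : Set R, IsOpen V ∧ (u : R) ∈ V ∧ (∀ x ∈ V, φ (Ring.inverse x) ∈ U) ∧
      ContDiffOn ℝ ∞ (fun x => f (φ (Ring.inverse x))) V ∧
      ∀ x, fderiv ℝ (fun x => f (φ (Ring.inverse x))) u x =
        fderiv ℝ f (φ ↑u⁻¹) (-φ (↑u⁻¹ * x * ↑u⁻¹)) := by
  have hinv : ContDiffOn ℝ ∞ (fun x : R => φ (Ring.inverse x)) {x : R | IsUnit x} := by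
    rintro _ ⟨w, rfl⟩
    exact ((LinearMap.toContinuousLinearMap φ).contDiff.contDiffAt.comp _
      (contDiffAt_ringInverse ℝ w)).contDiffWithinAt
  refine ⟨{x : R | IsUnit x} ∩ (fun x : R => φ (Ring.inverse x)) ⁻¹' U,
    hinv.continuousOn.isOpen_inter_preimage Units.isOpen hU, ⟨u.isUnit, by simpa using hu⟩,
    fun x hx => hx.2, hf.comp (hinv.mono Set.inter_subset_left) fun x hx => hx.2, fun x => ?_⟩
  have hd : HasFDerivAt f (fderiv ℝ f (φ ↑u⁻¹)) (φ (Ring.inverse (u : R))) := by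
    rw [Ring.inverse_unit]
    exact ((hf.contDiffAt (hU.mem_nhds hu)).differentiableAt (by simp)).hasFDerivAt
  have h := HasFDerivAt.comp (u : R) hd (HasFDerivAt.comp (u : R)
    (LinearMap.toContinuousLinearMap φ).hasFDerivAt (hasFDerivAt_ringInverse (𝕜 := ℝ) u))
  have h' : fderiv ℝ (fun x => f (φ (Ring.inverse x))) (u : R) = _ := h.fderiv
  rw [h']
  simp

end Pullback

section Restriction

open Module (Dual)

variable {E : Type*} [NormedAddCommGroup E] [NormedSpace ℝ E]

theorem IsInducedBracket.const_smul {X : Type*} {ι : X → E} {T : E → Dual ℝ E →ₗ[ℝ] E}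
    {br : (X → ℝ) → (X → ℝ) → (X → ℝ)} (hbr : IsInducedBracket ι T br) (c : ℝ) :
    IsInducedBracket ι (fun v => c • T v) fun F H => c • br F H := by
  intro U f h F H hU hf hh hF hH x hx
  simp [hbr hU hf hh hF hH x hx, fieldBracket]

theorem locallySmooth_id : locallySmooth (id : E → E) = {F : E → ℝ | ContDiff ℝ ∞ F} := by
  ext F
  constructor
  · intro hF
    change ContDiff ℝ ∞ F
    rw [contDiff_iff_contDiffAt]
    intro x
    obtain ⟨U, f, hU, hx, hf, hFf⟩ := hF x
    exact (hf.contDiffAt (hU.mem_nhds hx)).congr_of_eventuallyEq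
      (Filter.eventually_of_mem (hU.mem_nhds hx) hFf)
  · exact fun hF x => ⟨Set.univ, F, isOpen_univ, trivial, contDiffOn_univ.2 hF, fun _ _ => rfl⟩

theorem isInducedBracket_fieldBracket (T : E → Dual ℝ E →ₗ[ℝ] E) :
    IsInducedBracket id T (fieldBracket T) := by
  intro U f h F H hU hf hh hF hH x hx
  have h₁ : fderiv ℝ F x = fderiv ℝ f x :=
    Filter.EventuallyEq.fderiv_eq (Filter.eventually_of_mem (hU.mem_nhds hx) hF)
  have h₂ : fderiv ℝ H x = fderiv ℝ h x :=
    Filter.EventuallyEq.fderiv_eq (Filter.eventually_of_mem (hU.mem_nhds hx) hH)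
  rw [fieldBracket, h₁, h₂]
  rfl

end Restriction

/-! ### The r-matrix -/

section RMatrix

variable {n : ℕ}

theorem projK_mem (X : Mat n n) : projK n X ∈ frakK n :=
  Submodule.projection_apply_mem _ _

theorem projB_mem (X : Mat n n) : projB n X ∈ frakB n :=
  Submodule.projection_apply_mem _ _

theorem projK_add_projB (X : Mat n n) : projK n X + projB n X = X :=
  Submodule.projection_add_projection_eq_self (isCompl_frakK_frakB n) X

theorem projK_of_mem {X : Mat n n} (hX : X ∈ frakK n) : projK n X = X :=
  (Submodule.projection_eq_self_iff _ _).2 hX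

theorem rMat_apply (X : Mat n n) : rMat n X = projK n X - projB n X := rfl

theorem rMat_of_mem_frakK {X : Mat n n} (hX : X ∈ frakK n) : rMat n X = X := by
  have h := projK_add_projB X
  rw [projK_of_mem hX, add_eq_left] at h
  rw [rMat_apply, projK_of_mem hX, h, sub_zero]

theorem ip_comm (X Y : Mat n n) : ip X Y = ip Y X := by
  rw [ip, ip, Matrix.trace_mul_comm]

theorem ip_add_left (X Y Z : Mat n n) : ip (X + Y) Z = ip X Z + ip Y Z := by
  simp [ip, Matrix.add_mul]

theorem ip_add_right (X Y Z : Mat n n) : ip X (Y + Z) = ip X Y + ip X Z := by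
  simp [ip, Matrix.mul_add]

theorem ip_sub_left (X Y Z : Mat n n) : ip (X - Y) Z = ip X Z - ip Y Z := by
  simp [ip, Matrix.sub_mul]

theorem ip_sub_right (X Y Z : Mat n n) : ip X (Y - Z) = ip X Y - ip X Z := by
  simp [ip, Matrix.mul_sub]

theorem mul_mem_frakB {X Y : Mat n n} (hX : X ∈ frakB n) (hY : Y ∈ frakB n) : X * Y ∈ frakB n := by
  have key : ∀ i j k, j ≤ i → ¬(k = i ∧ i = j) → X i k * Y k j = 0 := by
    intro i j k hji hk
    rcases lt_trichotomy k i with h | h | h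
    · rw [hX.1 i k h, zero_mul]
    · subst h
      rw [hY.1 k j (lt_of_le_of_ne hji fun h => hk ⟨rfl, h.symm⟩), mul_zero]
    · rw [hY.1 k j (hji.trans_lt h), mul_zero]
  refine ⟨fun i j hij => ?_, fun i => ?_⟩
  · rw [Matrix.mul_apply]
    exact Finset.sum_eq_zero fun k _ => key i j k hij.le fun h => hij.ne' h.2
  · rw [Matrix.mul_apply, Finset.sum_eq_single i (fun k _ hk => key i i k le_rfl fun h => hk h.1)
      (by simp), Complex.mul_im, hX.2 i, hY.2 i]
    simp

theorem trace_im_of_mem_frakB {X : Mat n n} (hX : X ∈ frakB n) : X.trace.im = 0 := by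
  rw [Matrix.trace, Complex.im_sum]
  exact Finset.sum_eq_zero fun i _ => hX.2 i

theorem ip_frakB {X Y : Mat n n} (hX : X ∈ frakB n) (hY : Y ∈ frakB n) : ip X Y = 0 :=
  trace_im_of_mem_frakB (mul_mem_frakB hX hY)

theorem conjTranspose_of_mem_frakK {X : Mat n n} (hX : X ∈ frakK n) : Xᴴ = -X :=
  eq_neg_of_add_eq_zero_right hX

theorem trace_conjTranspose_im (X : Mat n n) : Xᴴ.trace.im = -X.trace.im := by
  rw [Matrix.trace_conjTranspose]
  simp

theorem ip_frakK {X Y : Mat n n} (hX : X ∈ frakK n) (hY : Y ∈ frakK n) : ip X Y = 0 := by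
  have h := trace_conjTranspose_im (X * Y)
  rw [Matrix.conjTranspose_mul, conjTranspose_of_mem_frakK hX, conjTranspose_of_mem_frakK hY,
    neg_mul_neg, Matrix.trace_mul_comm] at h
  rw [ip]
  linarith

/-- The r-matrix is antisymmetric, because `𝔨` and `𝔟` are isotropic. -/
theorem ip_rMat (X Y : Mat n n) : ip X (rMat n Y) = -ip (rMat n X) Y := by
  conv_lhs => rw [← projK_add_projB X]
  conv_rhs => rw [← projK_add_projB Y]
  simp only [rMat_apply, ip_add_left, ip_add_right, ip_sub_left, ip_sub_right,
    ip_frakK (projK_mem X) (projK_mem Y), ip_frakB (projB_mem X) (projB_mem Y)]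
  ring

theorem rMat_eq_two_smul (X : Mat n n) : rMat n X = (2 : ℝ) • projK n X - X := by
  conv_rhs => rw [← projK_add_projB X, map_add, projK_of_mem (projK_mem X)]
  have : projK n (projB n X) = 0 := by
    have h := congrArg (projK n) (projK_add_projB X)
    rwa [map_add, projK_of_mem (projK_mem X), add_eq_left] at h
  rw [rMat_apply, this, two_smul]
  abel

/-- The real cubic form `Im tr (X Y Z)`. -/
def tri (X Y Z : Mat n n) : ℝ := (X * Y * Z).trace.im

theorem tri_cyc (X Y Z : Mat n n) : tri X Y Z = tri Y Z X := by
  rw [tri, tri, Matrix.mul_assoc, Matrix.trace_mul_comm]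

theorem tri_frakK {X Y Z : Mat n n} (hX : X ∈ frakK n) (hY : Y ∈ frakK n) (hZ : Z ∈ frakK n) :
    tri X Y Z = tri Y X Z := by
  have h := trace_conjTranspose_im (X * Y * Z)
  rw [Matrix.conjTranspose_mul, Matrix.conjTranspose_mul, conjTranspose_of_mem_frakK hX,
    conjTranspose_of_mem_frakK hY, conjTranspose_of_mem_frakK hZ] at h
  simp only [neg_mul_neg, Matrix.neg_mul, Matrix.trace_neg, Complex.neg_im] at h
  rw [Matrix.trace_mul_comm] at h
  rw [tri, tri]
  linarith

theorem tri_frakB {X Y Z : Mat n n} (hX : X ∈ frakB n) (hY : Y ∈ frakB n) (hZ : Z ∈ frakB n) :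
    tri X Y Z = 0 :=
  trace_im_of_mem_frakB (mul_mem_frakB (mul_mem_frakB hX hY) hZ)

/-- The modified classical Yang–Baxter equation for `R`, paired with a third element and written as a
cyclic sum by means of the antisymmetry of `R`.  Only the vanishing of the form `Im tr ([X, Y] Z)` on
`𝔨` and on `𝔟` is needed: both are isotropic subalgebras. -/
theorem yangBaxter (X Y Z : Mat n n) :
    (tri (rMat n X) (rMat n Y) Z - tri (rMat n Y) (rMat n X) Z) +
    (tri (rMat n Y) (rMat n Z) X - tri (rMat n Z) (rMat n Y) X) +
    (tri (rMat n Z) (rMat n X) Y - tri (rMat n X) (rMat n Z) Y) = -(tri X Y Z - tri Y X Z) := by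
  have hadd₁ : ∀ a b c d : Mat n n, tri (a + b) c d = tri a c d + tri b c d := by
    simp [tri, Matrix.add_mul]
  have hadd₂ : ∀ a b c d : Mat n n, tri c (a + b) d = tri c a d + tri c b d := by
    simp [tri, Matrix.add_mul, Matrix.mul_add]
  have hadd₃ : ∀ a b c d : Mat n n, tri c d (a + b) = tri c d a + tri c d b := by
    simp [tri, Matrix.mul_add]
  have hsub₁ : ∀ a b c d : Mat n n, tri (a - b) c d = tri a c d - tri b c d := by
    simp [tri, Matrix.sub_mul]
  have hsub₂ : ∀ a b c d : Mat n n, tri c (a - b) d = tri c a d - tri c b d := by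
    simp [tri, Matrix.sub_mul, Matrix.mul_sub]
  have hsub₃ : ∀ a b c d : Mat n n, tri c d (a - b) = tri c d a - tri c d b := by
    simp [tri, Matrix.mul_sub]
  have key : ∀ k₁ ∈ frakK n, ∀ k₂ ∈ frakK n, ∀ k₃ ∈ frakK n, ∀ b₁ ∈ frakB n, ∀ b₂ ∈ frakB n,
      ∀ b₃ ∈ frakB n,
      (tri (k₁ - b₁) (k₂ - b₂) (k₃ + b₃) - tri (k₂ - b₂) (k₁ - b₁) (k₃ + b₃)) +
      (tri (k₂ - b₂) (k₃ - b₃) (k₁ + b₁) - tri (k₃ - b₃) (k₂ - b₂) (k₁ + b₁)) +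
      (tri (k₃ - b₃) (k₁ - b₁) (k₂ + b₂) - tri (k₁ - b₁) (k₃ - b₃) (k₂ + b₂)) =
      -(tri (k₁ + b₁) (k₂ + b₂) (k₃ + b₃) - tri (k₂ + b₂) (k₁ + b₁) (k₃ + b₃)) := by
    intro k₁ h₁ k₂ h₂ k₃ h₃ b₁ g₁ b₂ g₂ b₃ g₃
    have hk := tri_frakK h₁ h₂ h₃
    have hb := tri_frakB g₁ g₂ g₃
    have hb' := tri_frakB g₂ g₁ g₃
    have hcyc : ∀ a b c : Mat n n, tri b c a = tri a b c := fun a b c => (tri_cyc a b c).symm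
    rw [hcyc (k₁ + b₁) (k₂ - b₂), tri_cyc (k₃ - b₃) (k₂ - b₂), tri_cyc (k₃ - b₃) (k₁ - b₁),
      hcyc (k₂ + b₂) (k₁ - b₁)]
    simp only [hadd₁, hadd₂, hadd₃, hsub₁, hsub₂, hsub₃]
    -- Mixed words in `k` and `b` have coefficient `-1` on both sides, pure ones `3` against `-1`.
    linear_combination 4 * hk + 4 * hb - 4 * hb'
  simpa only [projK_add_projB, ← rMat_apply] using key _ (projK_mem X) _ (projK_mem Y) _
    (projK_mem Z) _ (projB_mem X) _ (projB_mem Y) _ (projB_mem Z)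

end RMatrix

/-! ### The bivectors `R_M + ε ρ_M - 2 λ Π` are Poisson tensors -/

attribute [local instance] Matrix.linftyOpNormedAddCommGroup Matrix.linftyOpNormedSpace

section Tensor

variable {n d m : ℕ}

theorem cov_apply (ξ v : Mat n d) : cov n d ξ v = (ξᴴ * v).trace.im := rfl

theorem sharp_eq {φ : Module.Dual ℝ (Mat n n)} {D : Mat n n} (h : ∀ X, φ X = ip D X) :
    sharp φ = D := by
  have : φ = cov n n Dᴴ := LinearMap.ext fun X => by
    rw [h, cov_apply, Matrix.conjTranspose_conjTranspose, ip]
  rw [sharp, this, LinearEquiv.symm_apply_apply, Matrix.conjTranspose_conjTranspose]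

theorem sharp_cov_infLeft (ξ v : Mat n d) : sharp (cov n d ξ ∘ₗ infLeft v) = v * ξᴴ :=
  sharp_eq fun X => by
    rw [ip, Matrix.mul_assoc, Matrix.trace_mul_comm, Matrix.mul_assoc]
    rfl

theorem sharp_cov_infRight (ξ v : Mat n d) : sharp (cov n d ξ ∘ₗ infRight v) = -(ξᴴ * v) :=
  sharp_eq fun X => by
    change (ξᴴ * -(v * X)).trace.im = _
    rw [ip, Matrix.mul_neg, Matrix.neg_mul, Matrix.mul_assoc]

theorem pushTensor_apply (r : Mat m m →ₗ[ℝ] Mat m m) (a : Mat m m →ₗ[ℝ] Mat n d)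
    (α β : Module.Dual ℝ (Mat n d)) :
    pushTensor r a α β = α (a (r (sharp (β ∘ₗ a)))) :=
  ip_sharp _ _

/-- The bilinear part of the sharp map, at a fixed covector `ξ`, polarized in `v`. -/
noncomputable def sharpBilin (ε : ℝ) (ξ : Mat n d) : Mat n d →ₗ[ℝ] Mat n d →ₗ[ℝ] Mat n d :=
  LinearMap.mk₂ ℝ (fun v w => rMat n (v * ξᴴ) * w + ε • (v * rMat d (ξᴴ * w)))
    (fun v v' w => by simp only [Matrix.add_mul, map_add, smul_add]; abel)
    (fun c v w => by simp [smul_comm c])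
    (fun v w w' => by simp only [Matrix.mul_add, map_add, smul_add]; abel)
    (fun c v w => by simp [smul_comm c])

/-- The sharp map of `R_M + ε ρ_M - 2 λ Π`. -/
noncomputable def matField (n d : ℕ) (ε lam : ℝ) (v : Mat n d) :
    Module.Dual ℝ (Mat n d) →ₗ[ℝ] Mat n d where
  toFun α := sharpBilin ε ((cov n d).symm α) v v - (2 * lam) • (cov n d).symm α
  map_add' α β := by
    simp only [sharpBilin, LinearMap.mk₂_apply, map_add, Matrix.conjTranspose_add, Matrix.mul_add,
      Matrix.add_mul, smul_add]
    abel
  map_smul' c α := by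
    simp only [sharpBilin, LinearMap.mk₂_apply, map_smul, Matrix.conjTranspose_smul,
      Matrix.mul_smul, Matrix.smul_mul, star_trivial, RingHom.id_apply, smul_sub, smul_add,
      smul_comm c]

theorem matField_cov (ε lam : ℝ) (v ξ : Mat n d) : matField n d ε lam v (cov n d ξ) =
    rMat n (v * ξᴴ) * v + ε • (v * rMat d (ξᴴ * v)) - (2 * lam) • ξ := by
  simp [matField, sharpBilin]

/-- The map `matField` is indeed the sharp map of the bivector.  The sign in the right action is
irrelevant, as it occurs twice. -/
theorem bivector_eq_matField (ε lam : ℝ) (v : Mat n d) (α β : Module.Dual ℝ (Mat n d)) :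
    (bivR n d + ε • bivRho n d - (2 * lam) • bivPi n d) v α β = α (matField n d ε lam v β) := by
  obtain ⟨η, rfl⟩ := (cov n d).surjective β
  obtain ⟨ξ, rfl⟩ := (cov n d).surjective α
  rw [matField_cov]
  change pushTensor _ _ _ _ + ε * pushTensor _ _ _ _ - 2 * lam * bivPi n d v _ _ = _
  rw [pushTensor_apply, pushTensor_apply, sharp_cov_infLeft, sharp_cov_infRight]
  simp only [bivPi, LinearEquiv.symm_apply_apply, map_sub, map_add, map_smul, map_neg,
    smul_eq_mul]
  simp [infLeft, infRight, cov_apply]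

theorem cov_mul_left (ξ x : Mat n d) (A : Mat n n) : cov n d ξ (A * x) = ip A (x * ξᴴ) := by
  rw [cov_apply, ip, Matrix.trace_mul_comm, Matrix.mul_assoc]

theorem cov_mul_right (ξ x : Mat n d) (B : Mat d d) : cov n d ξ (x * B) = ip B (ξᴴ * x) := by
  rw [cov_apply, ip_comm, ip, Matrix.mul_assoc]

theorem matField_skew (ε lam : ℝ) (v : Mat n d) (α β : Module.Dual ℝ (Mat n d)) :
    α (matField n d ε lam v β) = -β (matField n d ε lam v α) := by
  obtain ⟨η, rfl⟩ := (cov n d).surjective β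
  obtain ⟨ξ, rfl⟩ := (cov n d).surjective α
  have hs : (ηᴴ * ξ).trace.im = -(ξᴴ * η).trace.im := by
    rw [← trace_conjTranspose_im, Matrix.conjTranspose_mul, Matrix.conjTranspose_conjTranspose]
  simp only [matField_cov, map_add, map_sub, map_smul, cov_mul_left, cov_mul_right, smul_eq_mul]
  rw [ip_comm, ip_rMat, ip_comm (rMat d (ηᴴ * v)), ip_rMat, cov_apply, cov_apply, hs]
  ring

theorem contDiff_matField (ε lam : ℝ) (α : Module.Dual ℝ (Mat n d)) :
    ContDiff ℝ ∞ fun v => matField n d ε lam v α := by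
  have := contDiff_quadratic (sharpBilin ε ((cov n d).symm α)) (-((2 * lam) • (cov n d).symm α))
  simp only [← sub_eq_add_neg] at this
  exact this

theorem fderiv_matField (ε lam : ℝ) (ξ v x : Mat n d) :
    fderiv ℝ (fun w => matField n d ε lam w (cov n d ξ)) v x =
      rMat n (v * ξᴴ) * x + ε • (v * rMat d (ξᴴ * x)) +
      (rMat n (x * ξᴴ) * v + ε • (x * rMat d (ξᴴ * v))) := by
  have := fderiv_quadratic (sharpBilin ε ξ) (-((2 * lam) • ξ)) v x
  simp only [matField, LinearMap.coe_mk, AddHom.coe_mk, LinearEquiv.symm_apply_apply,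
    sub_eq_add_neg]
  exact this

/-- One of the three cyclic terms of the Schouten bracket, with a free tangent vector `x`; the
antisymmetry of `R` moves it off every factor which contains `x`. -/
theorem schouten_term (ε : ℝ) (v x ξ η : Mat n d) :
    cov n d ξ (rMat n (v * ηᴴ) * x + ε • (v * rMat d (ηᴴ * x)) +
      (rMat n (x * ηᴴ) * v + ε • (x * rMat d (ηᴴ * v)))) =
    ip (rMat n (v * ηᴴ)) (x * ξᴴ) - ip (rMat n (v * ξᴴ)) (x * ηᴴ) +
    ε * (ip (rMat d (ηᴴ * v)) (ξᴴ * x) - ip (rMat d (ξᴴ * v)) (ηᴴ * x)) := by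
  simp only [map_add, map_smul, cov_mul_left, cov_mul_right, smul_eq_mul]
  rw [ip_comm (rMat n (x * ηᴴ)), ip_rMat, ip_comm (rMat d (ηᴴ * x)), ip_rMat]
  ring

/-- The trace `Im tr (R(v α†) v R(β† v) γ†)`, which pairs the left and the right r-matrix. -/
noncomputable def mixedTrace (v α β γ : Mat n d) : ℝ :=
  (rMat n (v * αᴴ) * v * rMat d (βᴴ * v) * γᴴ).trace.im

theorem schouten_term_matField (ε lam : ℝ) (v ξ η ζ : Mat n d) :
    cov n d ξ (fderiv ℝ (fun w => matField n d ε lam w (cov n d ζ)) v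
      (matField n d ε lam v (cov n d η))) =
    tri (rMat n (v * ζᴴ)) (rMat n (v * ηᴴ)) (v * ξᴴ) -
      tri (rMat n (v * ξᴴ)) (rMat n (v * ηᴴ)) (v * ζᴴ) +
    ε * ε * (tri (rMat d (ηᴴ * v)) (rMat d (ζᴴ * v)) (ξᴴ * v) -
      tri (rMat d (ηᴴ * v)) (rMat d (ξᴴ * v)) (ζᴴ * v)) +
    ε * (mixedTrace v ζ η ξ - mixedTrace v ξ η ζ + mixedTrace v η ζ ξ - mixedTrace v η ξ ζ) -
    2 * lam * (ip (rMat n (v * ζᴴ)) (η * ξᴴ) - ip (rMat n (v * ξᴴ)) (η * ζᴴ) +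
      ε * (ip (rMat d (ζᴴ * v)) (ξᴴ * η) - ip (rMat d (ξᴴ * v)) (ζᴴ * η))) := by
  have hl : ∀ α β γ : Mat n d, ip (rMat n (v * αᴴ))
      ((rMat n (v * βᴴ) * v + ε • (v * rMat d (βᴴ * v)) - (2 * lam) • β) * γᴴ) =
      tri (rMat n (v * αᴴ)) (rMat n (v * βᴴ)) (v * γᴴ) + ε * mixedTrace v α β γ -
      2 * lam * ip (rMat n (v * αᴴ)) (β * γᴴ) := by
    intro α β γ
    simp [ip, tri, mixedTrace, Matrix.mul_add, Matrix.mul_sub, Matrix.add_mul, Matrix.sub_mul,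
      Matrix.mul_assoc]
  have hr : ∀ α β γ : Mat n d, ip (rMat d (αᴴ * v))
      (γᴴ * (rMat n (v * βᴴ) * v + ε • (v * rMat d (βᴴ * v)) - (2 * lam) • β)) =
      ε * tri (rMat d (βᴴ * v)) (rMat d (αᴴ * v)) (γᴴ * v) + mixedTrace v β α γ -
      2 * lam * ip (rMat d (αᴴ * v)) (γᴴ * β) := by
    intro α β γ
    have h₁ : tri (rMat d (βᴴ * v)) (rMat d (αᴴ * v)) (γᴴ * v) =
        (rMat d (αᴴ * v) * (γᴴ * (v * rMat d (βᴴ * v)))).trace.im := by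
      rw [tri_cyc, tri]
      simp only [Matrix.mul_assoc]
    have h₂ : mixedTrace v β α γ = (rMat d (αᴴ * v) * (γᴴ * (rMat n (v * βᴴ) * v))).trace.im := by
      rw [mixedTrace, Matrix.mul_assoc, Matrix.trace_mul_comm]
      simp only [Matrix.mul_assoc]
    rw [h₁, h₂]
    simp [ip, Matrix.mul_add, Matrix.mul_sub]
    ring
  rw [fderiv_matField, schouten_term, matField_cov, hl, hl, hr, hr]
  ring

/-- The invariant cubic form of `𝔤_n` at the elements `v ξ†` equals that of `𝔤_d` at the `ξ† v`, so that
the contributions of the left and the right Yang–Baxter equations to the Schouten bracket cancel. -/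
theorem trace_cubic (v ξ η ζ : Mat n d) :
    tri (v * ξᴴ) (v * ηᴴ) (v * ζᴴ) = tri (ξᴴ * v) (ηᴴ * v) (ζᴴ * v) := by
  simp only [tri, Matrix.mul_assoc]
  rw [Matrix.trace_mul_comm]
  simp only [Matrix.mul_assoc]

theorem ip_rMat_of_mem_frakK (X : Mat n n) {Y : Mat n n} (hY : Y ∈ frakK n) :
    ip (rMat n X) Y = -ip X Y := by
  rw [← neg_eq_iff_eq_neg.2 (ip_rMat X Y), rMat_of_mem_frakK hY]

/-- `R` acts as the identity on the skew-Hermitian matrix `ξ η† - η ξ†`. -/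
theorem ip_mul_conjTranspose_sub (X : Mat n n) (ξ η : Mat n d) :
    ip (rMat n X) (ξ * ηᴴ) - ip (rMat n X) (η * ξᴴ) = ip X (η * ξᴴ) - ip X (ξ * ηᴴ) := by
  have h : ξ * ηᴴ - η * ξᴴ ∈ frakK n := by
    change _ + _ᴴ = _
    simp
  rw [← ip_sub_right, ip_rMat_of_mem_frakK _ h, ip_sub_right]
  ring

theorem ip_conjTranspose_mul_sub (X : Mat d d) (ξ η : Mat n d) :
    ip (rMat d X) (ξᴴ * η) - ip (rMat d X) (ηᴴ * ξ) = ip X (ηᴴ * ξ) - ip X (ξᴴ * η) := by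
  simpa using ip_mul_conjTranspose_sub X ξᴴ ηᴴ

theorem ip_left_eq_ip_right (v ξ η ζ : Mat n d) :
    ip (v * ξᴴ) (η * ζᴴ) = ip (ζᴴ * v) (ξᴴ * η) := by
  rw [ip, ip, ← Matrix.mul_assoc, Matrix.trace_mul_comm]
  simp only [Matrix.mul_assoc]

/-- The terms which are linear in `λ` cancel if the left and the right r-matrix enter with the same
sign. -/
theorem schouten_linear (v ξ η ζ : Mat n d) :
    ((ip (rMat n (v * ζᴴ)) (η * ξᴴ) - ip (rMat n (v * ξᴴ)) (η * ζᴴ) +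
      (ip (rMat d (ζᴴ * v)) (ξᴴ * η) - ip (rMat d (ξᴴ * v)) (ζᴴ * η))) +
    (ip (rMat n (v * ξᴴ)) (ζ * ηᴴ) - ip (rMat n (v * ηᴴ)) (ζ * ξᴴ) +
      (ip (rMat d (ξᴴ * v)) (ηᴴ * ζ) - ip (rMat d (ηᴴ * v)) (ξᴴ * ζ)))) +
    (ip (rMat n (v * ηᴴ)) (ξ * ζᴴ) - ip (rMat n (v * ζᴴ)) (ξ * ηᴴ) +
      (ip (rMat d (ηᴴ * v)) (ζᴴ * ξ) - ip (rMat d (ζᴴ * v)) (ηᴴ * ξ))) = 0 := by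
  linear_combination ip_mul_conjTranspose_sub (v * ζᴴ) η ξ + ip_mul_conjTranspose_sub (v * ξᴴ) ζ η +
    ip_mul_conjTranspose_sub (v * ηᴴ) ξ ζ + ip_conjTranspose_mul_sub (ζᴴ * v) ξ η +
    ip_conjTranspose_mul_sub (ξᴴ * v) η ζ + ip_conjTranspose_mul_sub (ηᴴ * v) ζ ξ +
    ip_left_eq_ip_right v ζ ξ η - ip_left_eq_ip_right v ζ η ξ + ip_left_eq_ip_right v ξ η ζ -
    ip_left_eq_ip_right v ξ ζ η + ip_left_eq_ip_right v η ζ ξ - ip_left_eq_ip_right v η ξ ζ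

theorem isPoissonField_matField {ε lam : ℝ} (hε : ε * ε = 1) (hlam : lam = 0 ∨ ε = 1) :
    IsPoissonField (matField n d ε lam) where
  contDiff := contDiff_matField ε lam
  skew := matField_skew ε lam
  schouten v α β γ := by
    obtain ⟨ξ, rfl⟩ := (cov n d).surjective α
    obtain ⟨η, rfl⟩ := (cov n d).surjective β
    obtain ⟨ζ, rfl⟩ := (cov n d).surjective γ
    refine (congrArg₂ (· + ·) (congrArg₂ (· + ·) (schouten_term_matField ε lam v ξ η ζ)
      (schouten_term_matField ε lam v η ζ ξ)) (schouten_term_matField ε lam v ζ ξ η)).trans ?_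
    rw [hε]
    have hl := yangBaxter (v * ξᴴ) (v * ηᴴ) (v * ζᴴ)
    have hr := yangBaxter (ξᴴ * v) (ηᴴ * v) (ζᴴ * v)
    have h₁ := trace_cubic v ξ η ζ
    have h₂ := trace_cubic v η ξ ζ
    have h₃ := schouten_linear v ξ η ζ
    rcases hlam with rfl | rfl
    · linear_combination -hl + hr + h₁ - h₂
    · linear_combination -hl + hr + h₁ - h₂ - 2 * lam * h₃

end Tensor

/-! ### Multiplicativity of the bivectors -/

section Action

variable {n d m : ℕ}

theorem pushTensor_neg (r : Mat m m →ₗ[ℝ] Mat m m) (a : Mat m m →ₗ[ℝ] Mat n d)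
    (α β : Module.Dual ℝ (Mat n d)) : pushTensor r (-a) α β = pushTensor r a α β := by
  have h : ∀ φ : Module.Dual ℝ (Mat m m), sharp (-φ) = -sharp φ := fun φ => by
    simp [sharp]
  simp only [pushTensor, LinearMap.comp_neg, h, map_neg]
  simp [ip]

theorem bivPi_comp_mulLeftLinearMap {A : Mat n n} (hA : A * Aᴴ = 1) (v w : Mat n d)
    (α β : Module.Dual ℝ (Mat n d)) :
    bivPi n d v (α ∘ₗ mulLeftLinearMap (Fin d) ℝ A) (β ∘ₗ mulLeftLinearMap (Fin d) ℝ A) =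
      bivPi n d w α β := by
  have h : ∀ α : Module.Dual ℝ (Mat n d),
      (cov n d).symm (α ∘ₗ mulLeftLinearMap (Fin d) ℝ A) = Aᴴ * (cov n d).symm α := by
    intro α
    obtain ⟨ξ, rfl⟩ := (cov n d).surjective α
    rw [LinearEquiv.symm_apply_apply, LinearEquiv.symm_apply_eq]
    refine LinearMap.ext fun v => ?_
    change (ξᴴ * (A * v)).trace.im = ((Aᴴ * ξ)ᴴ * v).trace.im
    simp [Matrix.mul_assoc]
  rw [bivPi, bivPi, h, h, Matrix.conjTranspose_mul, Matrix.conjTranspose_conjTranspose,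
    Matrix.mul_assoc, ← Matrix.mul_assoc A, hA, Matrix.one_mul]

theorem bivPi_comp_mulRightLinearMap {B : Mat d d} (hB : B * Bᴴ = 1) (v w : Mat n d)
    (α β : Module.Dual ℝ (Mat n d)) :
    bivPi n d v (α ∘ₗ mulRightLinearMap (Fin n) ℝ B) (β ∘ₗ mulRightLinearMap (Fin n) ℝ B) =
      bivPi n d w α β := by
  have h : ∀ α : Module.Dual ℝ (Mat n d),
      (cov n d).symm (α ∘ₗ mulRightLinearMap (Fin n) ℝ B) = (cov n d).symm α * Bᴴ := by
    intro α
    obtain ⟨ξ, rfl⟩ := (cov n d).surjective α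
    rw [LinearEquiv.symm_apply_apply, LinearEquiv.symm_apply_eq]
    refine LinearMap.ext fun v => ?_
    change (ξᴴ * (v * B)).trace.im = ((ξ * Bᴴ)ᴴ * v).trace.im
    rw [Matrix.conjTranspose_mul, Matrix.conjTranspose_conjTranspose, Matrix.mul_assoc,
      Matrix.trace_mul_comm B, Matrix.mul_assoc]
  rw [bivPi, bivPi, h, h, Matrix.conjTranspose_mul, Matrix.conjTranspose_conjTranspose,
    Matrix.trace_mul_comm, Matrix.mul_assoc, ← Matrix.mul_assoc Bᴴ, mul_eq_one_comm.1 hB,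
    Matrix.one_mul, Matrix.trace_mul_comm]

/-- The bivector `R_M + ε ρ_M - 2 λ Π` is multiplicative under left multiplication. -/
theorem matField_mul_left {ε lam : ℝ} {A : Mat n n} (h : lam = 0 ∨ A * Aᴴ = 1) (v : Mat n d)
    (α β : Module.Dual ℝ (Mat n d)) :
    α (matField n d ε lam (A * v) β) =
      (α ∘ₗ infLeft v) (matField n n (-1) 0 A (β ∘ₗ infLeft v)) +
      (α ∘ₗ mulLeftLinearMap (Fin d) ℝ A)
        (matField n d ε lam v (β ∘ₗ mulLeftLinearMap (Fin d) ℝ A)) := by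
  simp only [← bivector_eq_matField]
  have h₁ : infLeft v ∘ₗ infLeft A = infLeft (A * v) :=
    LinearMap.ext fun X => Matrix.mul_assoc X A v
  have h₂ : infLeft v ∘ₗ infRight A = -(mulLeftLinearMap (Fin d) ℝ A ∘ₗ infLeft v) :=
    LinearMap.ext fun X => by
      change -(A * X) * v = -(A * (X * v))
      rw [Matrix.neg_mul, Matrix.mul_assoc]
  have h₃ : mulLeftLinearMap (Fin d) ℝ A ∘ₗ infRight v = infRight (A * v) :=
    LinearMap.ext fun X => by
      change A * -(v * X) = -(A * v * X)
      rw [Matrix.mul_neg, Matrix.mul_assoc]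
  have e₁ : bivR n n A (α ∘ₗ infLeft v) (β ∘ₗ infLeft v) = bivR n d (A * v) α β := by
    simp only [bivR, ← h₁]
    rfl
  have e₂ : bivRho n n A (α ∘ₗ infLeft v) (β ∘ₗ infLeft v) =
      bivR n d v (α ∘ₗ mulLeftLinearMap (Fin d) ℝ A) (β ∘ₗ mulLeftLinearMap (Fin d) ℝ A) := by
    change pushTensor (rMat n) (infLeft v ∘ₗ infRight A) α β =
      pushTensor (rMat n) (mulLeftLinearMap (Fin d) ℝ A ∘ₗ infLeft v) α β
    rw [h₂, pushTensor_neg]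
  have e₃ : bivRho n d v (α ∘ₗ mulLeftLinearMap (Fin d) ℝ A) (β ∘ₗ mulLeftLinearMap (Fin d) ℝ A) =
      bivRho n d (A * v) α β := by
    simp only [bivRho, ← h₃]
    rfl
  have e₄ : lam * bivPi n d v (α ∘ₗ mulLeftLinearMap (Fin d) ℝ A)
      (β ∘ₗ mulLeftLinearMap (Fin d) ℝ A) =
      lam * bivPi n d (A * v) α β := by
    rcases h with rfl | h
    · simp
    · rw [bivPi_comp_mulLeftLinearMap h v (A * v)]
  simp only [Pi.add_apply, Pi.sub_apply, Pi.smul_apply, smul_eq_mul, e₁, e₂, e₃]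
  linear_combination 2 * e₄

/-- The bivector `R_M + ρ_M - 2 λ Π` is multiplicative under `(A, v) ↦ v A⁻¹`; here `B = A⁻¹`, and
`X ↦ -v B X B` is the differential of `A ↦ v A⁻¹`. -/
theorem matField_mul_right {lam : ℝ} {A B : Mat d d} (hBA : B * A = 1)
    (h : lam = 0 ∨ B * Bᴴ = 1) (v : Mat n d) (α β : Module.Dual ℝ (Mat n d)) :
    α (matField n d 1 lam (v * B) β) =
      (α ∘ₗ infRight (v * B) ∘ₗ mulRightLinearMap (Fin d) ℝ B)
        (matField d d (-1) 0 A (β ∘ₗ infRight (v * B) ∘ₗ mulRightLinearMap (Fin d) ℝ B)) +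
      (α ∘ₗ mulRightLinearMap (Fin n) ℝ B)
        (matField n d 1 lam v (β ∘ₗ mulRightLinearMap (Fin n) ℝ B)) := by
  simp only [← bivector_eq_matField]
  have hAB : A * B = 1 := mul_eq_one_comm.1 hBA
  have h₁ : (infRight (v * B) ∘ₗ mulRightLinearMap (Fin d) ℝ B) ∘ₗ infLeft A = infRight (v * B) :=
    LinearMap.ext fun X => by
      change -(v * B * (X * A * B)) = -(v * B * X)
      rw [Matrix.mul_assoc X, hAB, Matrix.mul_one]
  have h₂ : (infRight (v * B) ∘ₗ mulRightLinearMap (Fin d) ℝ B) ∘ₗ infRight A =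
      -(mulRightLinearMap (Fin n) ℝ B ∘ₗ infRight v) :=
    LinearMap.ext fun X => by
      change -(v * B * (-(A * X) * B)) = -(-(v * X) * B)
      simp only [Matrix.neg_mul, Matrix.mul_neg, neg_neg, Matrix.mul_assoc]
      rw [← Matrix.mul_assoc B, hBA, Matrix.one_mul]
  have h₃ : mulRightLinearMap (Fin n) ℝ B ∘ₗ infLeft v = infLeft (v * B) :=
    LinearMap.ext fun X => Matrix.mul_assoc X v B
  have e₁ : bivR d d A (α ∘ₗ infRight (v * B) ∘ₗ mulRightLinearMap (Fin d) ℝ B)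
      (β ∘ₗ infRight (v * B) ∘ₗ mulRightLinearMap (Fin d) ℝ B) = bivRho n d (v * B) α β := by
    change pushTensor (rMat d) ((infRight (v * B) ∘ₗ mulRightLinearMap (Fin d) ℝ B) ∘ₗ
      infLeft A) α β = _
    rw [h₁]
    rfl
  have e₂ : bivRho d d A (α ∘ₗ infRight (v * B) ∘ₗ mulRightLinearMap (Fin d) ℝ B)
      (β ∘ₗ infRight (v * B) ∘ₗ mulRightLinearMap (Fin d) ℝ B) =
      bivRho n d v (α ∘ₗ mulRightLinearMap (Fin n) ℝ B) (β ∘ₗ mulRightLinearMap (Fin n) ℝ B) := by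
    change pushTensor (rMat d) ((infRight (v * B) ∘ₗ mulRightLinearMap (Fin d) ℝ B) ∘ₗ
      infRight A) α β =
      pushTensor (rMat d) (mulRightLinearMap (Fin n) ℝ B ∘ₗ infRight v) α β
    rw [h₂, pushTensor_neg]
  have e₃ : bivR n d v (α ∘ₗ mulRightLinearMap (Fin n) ℝ B) (β ∘ₗ mulRightLinearMap (Fin n) ℝ B) =
      bivR n d (v * B) α β := by
    simp only [bivR, ← h₃]
    rfl
  have e₄ : lam * bivPi n d v (α ∘ₗ mulRightLinearMap (Fin n) ℝ B)
      (β ∘ₗ mulRightLinearMap (Fin n) ℝ B) =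
      lam * bivPi n d (v * B) α β := by
    rcases h with rfl | h
    · simp
    · rw [bivPi_comp_mulRightLinearMap h v (v * B)]
  simp only [Pi.add_apply, Pi.sub_apply, Pi.smul_apply, smul_eq_mul, e₁, e₂, e₃]
  linear_combination 2 * e₄

theorem smul_matField_mul_left (c : ℝ) {ε lam : ℝ} {A : Mat n n} (h : lam = 0 ∨ A * Aᴴ = 1)
    (v : Mat n d) (α β : Module.Dual ℝ (Mat n d)) :
    α ((c • matField n d ε lam (A * v)) β) =
      (α ∘ₗ infLeft v) ((c • matField n n (-1) 0 A) (β ∘ₗ infLeft v)) +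
      (α ∘ₗ mulLeftLinearMap (Fin d) ℝ A)
        ((c • matField n d ε lam v) (β ∘ₗ mulLeftLinearMap (Fin d) ℝ A)) := by
  simp only [LinearMap.smul_apply, map_smul, smul_eq_mul, matField_mul_left h v α β, mul_add]

theorem smul_matField_mul_right (c : ℝ) {lam : ℝ} {A B : Mat d d} (hBA : B * A = 1)
    (h : lam = 0 ∨ B * Bᴴ = 1) (v : Mat n d) (α β : Module.Dual ℝ (Mat n d)) :
    α ((c • matField n d 1 lam (v * B)) β) =
      (α ∘ₗ infRight (v * B) ∘ₗ mulRightLinearMap (Fin d) ℝ B)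
        ((c • matField d d (-1) 0 A)
          (β ∘ₗ infRight (v * B) ∘ₗ mulRightLinearMap (Fin d) ℝ B)) +
      (α ∘ₗ mulRightLinearMap (Fin n) ℝ B)
        ((c • matField n d 1 lam v) (β ∘ₗ mulRightLinearMap (Fin n) ℝ B)) := by
  simp only [LinearMap.smul_apply, map_smul, smul_eq_mul, matField_mul_right hBA h v α β, mul_add]

end Action

/-! ### Poisson Lie groups and Poisson actions -/

section GroupBracket

variable {n d : ℕ} {G : Type*} [Group G] {c lam : ℝ}

theorem fieldBracket_comp {E F : Type*} [NormedAddCommGroup E] [NormedSpace ℝ E]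
    [FiniteDimensional ℝ E] [NormedAddCommGroup F] [NormedSpace ℝ F] (φ : E →ₗ[ℝ] F)
    (T : E → Module.Dual ℝ E →ₗ[ℝ] E) {U : Set F} (hU : IsOpen U) {f h : F → ℝ}
    (hf : ContDiffOn ℝ ∞ f U) (hh : ContDiffOn ℝ ∞ h U) {x : E} (hx : φ x ∈ U) :
    fieldBracket T (fun y => f (φ y)) (fun y => h (φ y)) x =
      ((fderiv ℝ f (φ x) : F →ₗ[ℝ] ℝ) ∘ₗ φ) (T x ((fderiv ℝ h (φ x) : F →ₗ[ℝ] ℝ) ∘ₗ φ)) := by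
  rw [fieldBracket, fderiv_comp_linearMap φ hU hh hx]
  exact congrArg (fun α : E →ₗ[ℝ] ℝ => α _) (fderiv_comp_linearMap φ hU hf hx)

theorem smoothMat_eq (n d : ℕ) : smoothMat n d = locallySmooth (id : Mat n d → Mat n d) :=
  locallySmooth_id.symm

theorem isPoissonField_smul_sklyanin (n : ℕ) (c : ℝ) :
    IsPoissonField fun v => c • matField n n (-1) 0 v :=
  (isPoissonField_matField (by norm_num) (Or.inl rfl)).const_smul c

/-- A group of matrices to which the Sklyanin bracket restricts is a Poisson Lie group. -/
theorem isPoissonLieGroup_of_isInducedBracket {ι : G →* Mat n n}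
    {br : (G → ℝ) → (G → ℝ) → (G → ℝ)}
    (hbr : IsInducedBracket ι (fun v => c • matField n n (-1) 0 v) br) :
    IsPoissonLieGroup (locallySmooth ι) br where
  poisson := hbr.isPoissonBracket (isPoissonField_smul_sklyanin n c)
  smooth_left F hF g₁ g := by
    obtain ⟨U, f, hU, hg, hf, hFf⟩ := hF (g₁ * g)
    rw [map_mul] at hg
    exact ⟨_, _, isOpen_preimage_linearMap (mulLeftLinearMap (Fin n) ℝ (ι g₁)) hU, hg,
      contDiffOn_comp_linearMap _ hf, fun y hy => by
        simpa using hFf (g₁ * y) (by rw [map_mul]; exact hy)⟩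
  smooth_right F hF g₂ g := by
    obtain ⟨U, f, hU, hg, hf, hFf⟩ := hF (g * g₂)
    rw [map_mul] at hg
    exact ⟨_, _, isOpen_preimage_linearMap (infLeft (ι g₂)) hU, hg,
      contDiffOn_comp_linearMap _ hf, fun y hy => by
        simpa using! hFf (y * g₂) (by rw [map_mul]; exact hy)⟩
  mult F hF H hH g₁ g₂ := by
    obtain ⟨U, f, h, hU, hx, hf, hh, hFf, hHh⟩ := exists_common_extension hF hH (g₁ * g₂)
    have hx' : ι g₁ * ι g₂ ∈ U := by rwa [map_mul] at hx
    rw [hbr hU hf hh hFf hHh _ hx,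
      hbr (isOpen_preimage_linearMap (infLeft (ι g₂)) hU) (contDiffOn_comp_linearMap _ hf)
        (contDiffOn_comp_linearMap _ hh)
        (fun y hy => by simpa using! hFf (y * g₂) (by rw [map_mul]; exact hy))
        (fun y hy => by simpa using! hHh (y * g₂) (by rw [map_mul]; exact hy)) g₁ hx',
      hbr (isOpen_preimage_linearMap (mulLeftLinearMap (Fin n) ℝ (ι g₁)) hU)
        (contDiffOn_comp_linearMap _ hf) (contDiffOn_comp_linearMap _ hh)
        (fun y hy => by simpa using hFf (g₁ * y) (by rw [map_mul]; exact hy))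
        (fun y hy => by simpa using hHh (g₁ * y) (by rw [map_mul]; exact hy)) g₂ hx',
      fieldBracket_comp _ _ hU hf hh (x := ι g₁) hx',
      fieldBracket_comp _ _ hU hf hh (x := ι g₂) hx', fieldBracket, map_mul]
    exact (smul_matField_mul_left c (ε := -1) (lam := 0) (A := ι g₁) (Or.inl rfl) (ι g₂)
      (fderiv ℝ f (ι g₁ * ι g₂) : Mat n n →ₗ[ℝ] ℝ)
      (fderiv ℝ h (ι g₁ * ι g₂) : Mat n n →ₗ[ℝ] ℝ)).symm

theorem bivP_eq (n d : ℕ) (lam : ℝ) :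
    bivP n d lam = bivR n d + (1 : ℝ) • bivRho n d - (2 * lam) • bivPi n d := by
  rw [bivP, one_smul]

theorem smul_bivP_apply (c lam : ℝ) (v : Mat n d) (α β : Module.Dual ℝ (Mat n d)) :
    (c • bivP n d lam) v α β = α ((c • matField n d 1 lam v) β) := by
  rw [LinearMap.smul_apply, map_smul, ← bivector_eq_matField, ← bivP_eq]
  rfl

theorem bivBracket_bivP (n d : ℕ) (c lam : ℝ) :
    bivBracket (c • bivP n d lam) = fieldBracket fun v => c • matField n d 1 lam v := by
  funext F H v
  exact smul_bivP_apply c lam v (fderiv ℝ F v : Mat n d →ₗ[ℝ] ℝ) (fderiv ℝ H v : Mat n d →ₗ[ℝ] ℝ)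

theorem isPoissonBracket_bivP (n d : ℕ) (c lam : ℝ) :
    IsPoissonBracket (smoothMat n d) (bivBracket (c • bivP n d lam)) := by
  rw [smoothMat_eq, bivBracket_bivP]
  exact (isInducedBracket_fieldBracket _).isPoissonBracket
    ((isPoissonField_matField (by norm_num) (Or.inr rfl)).const_smul c)

/-- The action by left multiplication of a group to which the Sklyanin bracket restricts.  The
normalization `c` is common to the group and to `M`. -/
theorem isPoissonAction_left {ι : G →* Mat n n} {br : (G → ℝ) → (G → ℝ) → (G → ℝ)}
    (hbr : IsInducedBracket ι (fun v => c • matField n n (-1) 0 v) br)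
    (hlam : lam = 0 ∨ ∀ g, ι g * (ι g)ᴴ = 1) :
    IsPoissonAction (locallySmooth ι) br (smoothMat n d) (bivBracket (c • bivP n d lam))
      (fun g v => ι g * v) where
  poissonLie := isPoissonLieGroup_of_isInducedBracket hbr
  poisson := isPoissonBracket_bivP n d c lam
  one_act v := by simp
  mul_act g₁ g₂ v := by simp [Matrix.mul_assoc]
  smooth_orbit F hF v g := ⟨_, _, isOpen_univ, trivial, contDiffOn_univ.2
    (contDiff_comp_linearMap (infLeft v : Mat n n →ₗ[ℝ] Mat n d) hF), fun _ _ => rfl⟩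
  smooth_translate F hF g := contDiff_comp_linearMap (mulLeftLinearMap (Fin d) ℝ (ι g)) hF
  map F hF H hH g v := by
    have hF' := contDiffOn_univ.2 (show ContDiff ℝ ∞ F from hF)
    have hH' := contDiffOn_univ.2 (show ContDiff ℝ ∞ H from hH)
    rw [bivBracket_bivP, hbr (F := fun g' => F (ι g' * v)) (H := fun g' => H (ι g' * v))
        (isOpen_preimage_linearMap (infLeft v : Mat n n →ₗ[ℝ] Mat n d) isOpen_univ)
        (contDiffOn_comp_linearMap _ hF') (contDiffOn_comp_linearMap _ hH')
        (fun _ _ => rfl) (fun _ _ => rfl) _ trivial,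
      fieldBracket_comp _ _ isOpen_univ hF' hH' (x := ι g) trivial]
    have h₁ := smul_matField_mul_left c (ε := 1) (hlam.imp_right fun h => h g) v
      (fderiv ℝ F (ι g * v) : Mat n d →ₗ[ℝ] ℝ) (fderiv ℝ H (ι g * v) : Mat n d →ₗ[ℝ] ℝ)
    have h₂ := fieldBracket_comp (mulLeftLinearMap (Fin d) ℝ (ι g))
      (fun v => c • matField n d 1 lam v) isOpen_univ hF' hH' (x := v) trivial
    exact h₁.trans (congrArg (_ + ·) h₂.symm)

/-- The function `X ↦ F (v X⁻¹)` and its differential, near an invertible matrix. -/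
theorem exists_comp_mul_inverse (v : Mat n d) {F : Mat n d → ℝ} (hF : ContDiff ℝ ∞ F)
    (u : (Mat d d)ˣ) :
    ∃ V : Set (Mat d d), IsOpen V ∧ (u : Mat d d) ∈ V ∧
      ContDiffOn ℝ ∞ (fun X => F (v * Ring.inverse X)) V ∧
      (fderiv ℝ (fun X => F (v * Ring.inverse X)) (u : Mat d d) : Mat d d →ₗ[ℝ] ℝ) =
        (fderiv ℝ F (v * (↑u⁻¹ : Mat d d)) : Mat n d →ₗ[ℝ] ℝ) ∘ₗ
          infRight (v * (↑u⁻¹ : Mat d d)) ∘ₗ mulRightLinearMap (Fin d) ℝ (↑u⁻¹ : Mat d d) := by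
  let : NormedRing (Mat d d) := Matrix.linftyOpNormedRing
  let : NormedAlgebra ℝ (Mat d d) := Matrix.linftyOpNormedAlgebra
  obtain ⟨V, hV, hu, -, hs, hd⟩ := exists_comp_inverse (mulLeftLinearMap (Fin d) ℝ v) isOpen_univ
    (contDiffOn_univ.2 hF) u trivial
  refine ⟨V, hV, hu, hs, LinearMap.ext fun x => (hd x).trans ?_⟩
  refine congrArg (fderiv ℝ F (v * (↑u⁻¹ : Mat d d))) ?_
  generalize (↑u⁻¹ : Mat d d) = B
  change -(v * (B * x * B)) = -(v * B * (x * B))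
  simp only [Matrix.mul_assoc]

/-- The action by right multiplication with inverses of a group to which the Sklyanin bracket
restricts. -/
theorem isPoissonAction_right {ι : G →* Mat d d} {br : (G → ℝ) → (G → ℝ) → (G → ℝ)}
    (hbr : IsInducedBracket ι (fun v => c • matField d d (-1) 0 v) br)
    (hlam : lam = 0 ∨ ∀ g, ι g * (ι g)ᴴ = 1) :
    IsPoissonAction (locallySmooth ι) br (smoothMat n d) (bivBracket (c • bivP n d lam))
      (fun g v => v * ι g⁻¹) where
  poissonLie := isPoissonLieGroup_of_isInducedBracket hbr
  poisson := isPoissonBracket_bivP n d c lam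
  one_act v := by simp
  mul_act g₁ g₂ v := by simp [Matrix.mul_assoc]
  smooth_orbit F hF v g := by
    obtain ⟨V, hV, hu, hs, -⟩ := exists_comp_mul_inverse v hF (Units.map ι (toUnits g))
    exact ⟨V, _, hV, hu, hs, fun y _ => congrArg (fun X => F (v * X))
      (Ring.inverse_unit (Units.map ι (toUnits y))).symm⟩
  smooth_translate F hF g := contDiff_comp_linearMap (mulRightLinearMap (Fin n) ℝ (ι g⁻¹)) hF
  map F hF H hH g v := by
    have hF' := contDiffOn_univ.2 (show ContDiff ℝ ∞ F from hF)
    have hH' := contDiffOn_univ.2 (show ContDiff ℝ ∞ H from hH)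
    obtain ⟨V, hV, hu, hs, e⟩ := exists_comp_mul_inverse v hF (Units.map ι (toUnits g))
    obtain ⟨V', hV', hu', hs', e'⟩ := exists_comp_mul_inverse v hH (Units.map ι (toUnits g))
    have hι : ι g⁻¹ * ι g = 1 := by rw [← map_mul, inv_mul_cancel, map_one]
    rw [bivBracket_bivP, hbr (F := fun g' => F (v * ι g'⁻¹)) (H := fun g' => H (v * ι g'⁻¹))
        (hV.inter hV') (hs.mono Set.inter_subset_left) (hs'.mono Set.inter_subset_right)
        (fun y _ => congrArg (fun X => F (v * X))
          (Ring.inverse_unit (Units.map ι (toUnits y))).symm)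
        (fun y _ => congrArg (fun X => H (v * X))
          (Ring.inverse_unit (Units.map ι (toUnits y))).symm) g ⟨hu, hu'⟩]
    have h₁ := smul_matField_mul_right c hι (hlam.imp_right fun h => h g⁻¹) v
      (fderiv ℝ F (v * ι g⁻¹) : Mat n d →ₗ[ℝ] ℝ) (fderiv ℝ H (v * ι g⁻¹) : Mat n d →ₗ[ℝ] ℝ)
    have h₂ := fieldBracket_comp (mulRightLinearMap (Fin n) ℝ (ι g⁻¹))
      (fun v => c • matField n d 1 lam v) isOpen_univ hF' hH' (x := v) trivial
    have h₃ := congrArg₂ (fun α β : Mat d d →ₗ[ℝ] ℝ => α ((c • matField d d (-1) 0 (ι g)) β)) e e'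
    exact h₁.trans (congrArg₂ (· + ·) h₃.symm h₂.symm)

end GroupBracket

/-! ### The Sklyanin and the Lu–Weinstein bracket as restrictions of a bivector -/

section Derivatives

variable {n : ℕ}

theorem hasDerivAt_of_path {E X : Type*} [NormedAddCommGroup E] [NormedSpace ℝ E] {ι : X → E}
    {U : Set E} (hU : IsOpen U) {f : E → ℝ} (hf : ContDiffOn ℝ ∞ f U) {F : X → ℝ}
    (hF : ∀ y, ι y ∈ U → F y = f (ι y)) {γ : ℝ → X} {w x : E}
    (hγ : HasDerivAt (fun t => ι (γ t)) w 0) (h0 : ι (γ 0) = x) (hx : x ∈ U) :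
    HasDerivAt (fun t => F (γ t)) (fderiv ℝ f x w) 0 := by
  subst h0
  have hd := ((hf.contDiffAt (hU.mem_nhds hx)).differentiableAt (by simp)).hasFDerivAt
  refine (hd.comp_hasDerivAt (0 : ℝ) hγ).congr_of_eventuallyEq ?_
  filter_upwards [hγ.continuousAt.preimage_mem_nhds (hU.mem_nhds hx)] with t ht using hF _ ht

theorem hasDerivAt_exp_mul (X A : Mat n n) :
    HasDerivAt (fun t : ℝ => NormedSpace.exp (t • X) * A) (X * A) 0 := by
  let : NormedRing (Mat n n) := Matrix.linftyOpNormedRing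
  let : NormedAlgebra ℝ (Mat n n) := Matrix.linftyOpNormedAlgebra
  have h := (hasDerivAt_exp_smul_const X (0 : ℝ)).mul_const A
  simp only [zero_smul, NormedSpace.exp_zero, one_mul] at h
  exact h

theorem hasDerivAt_mul_exp (X A : Mat n n) :
    HasDerivAt (fun t : ℝ => A * NormedSpace.exp (t • X)) (A * X) 0 := by
  let : NormedRing (Mat n n) := Matrix.linftyOpNormedRing
  let : NormedAlgebra ℝ (Mat n n) := Matrix.linftyOpNormedAlgebra
  have h := (hasDerivAt_exp_smul_const X (0 : ℝ)).const_mul A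
  simp only [zero_smul, NormedSpace.exp_zero, one_mul] at h
  exact h

theorem theMat_eq {p : Mat n n → Prop} {D : Mat n n} (hD : p D) (h : ∀ D', p D' → D' = D) :
    theMat p = D :=
  h _ (Classical.epsilon_spec ⟨D, hD⟩)

theorem ip_left_injective {D D' : Mat n n} (h : ∀ X, ip D X = ip D' X) : D = D' := by
  rw [← sharp_eq (φ := cov n n Dᴴ) (D := D') fun X => ?_, sharp_eq fun X => ?_]
  · rw [cov_apply, Matrix.conjTranspose_conjTranspose, ip]
  · rw [← h, cov_apply, Matrix.conjTranspose_conjTranspose, ip]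

/-- An element of `𝔟` is determined by its pairing with `𝔨`. -/
theorem eq_of_mem_frakB {D D' : Mat n n} (hD : D ∈ frakB n) (hD' : D' ∈ frakB n)
    (h : ∀ X ∈ frakK n, ip X D = ip X D') : D = D' := by
  refine ip_left_injective fun X => ?_
  rw [← projK_add_projB X, ip_add_right, ip_add_right, ip_comm, h _ (projK_mem X), ip_comm,
    ip_frakB hD (projB_mem X), ip_frakB hD' (projB_mem X)]

variable {U : Set (Mat n n)} {f : Mat n n → ℝ}

theorem theMat_isLeftDerivGL (hU : IsOpen U) (hf : ContDiffOn ℝ ∞ f U) {F : GLn n → ℝ}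
    (hF : ∀ y : GLn n, (y : Mat n n) ∈ U → F y = f y) {g : GLn n} (hg : (g : Mat n n) ∈ U) :
    theMat (IsLeftDerivGL F g) =
      sharp ((fderiv ℝ f g : Mat n n →ₗ[ℝ] ℝ) ∘ₗ infLeft (g : Mat n n)) := by
  have h : IsLeftDerivGL F g
      (sharp ((fderiv ℝ f g : Mat n n →ₗ[ℝ] ℝ) ∘ₗ infLeft (g : Mat n n))) := fun X => by
    rw [ip_sharp]
    exact hasDerivAt_of_path (ι := fun g : GLn n => (g : Mat n n)) hU hf hF
      (hasDerivAt_exp_mul X g) (by simp [expGL]) hg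
  exact theMat_eq h fun D' hD' => ip_left_injective fun X => (hD' X).unique (h X)

theorem theMat_isRightDerivGL (hU : IsOpen U) (hf : ContDiffOn ℝ ∞ f U) {F : GLn n → ℝ}
    (hF : ∀ y : GLn n, (y : Mat n n) ∈ U → F y = f y) {g : GLn n} (hg : (g : Mat n n) ∈ U) :
    theMat (IsRightDerivGL F g) = sharp ((fderiv ℝ f g : Mat n n →ₗ[ℝ] ℝ) ∘ₗ
      mulLeftLinearMap (Fin n) ℝ (g : Mat n n)) := by
  have h : IsRightDerivGL F g (sharp ((fderiv ℝ f g : Mat n n →ₗ[ℝ] ℝ) ∘ₗ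
      mulLeftLinearMap (Fin n) ℝ (g : Mat n n))) := fun X => by
    rw [ip_sharp]
    exact hasDerivAt_of_path (ι := fun g : GLn n => (g : Mat n n)) hU hf hF
      (hasDerivAt_mul_exp X g) (by simp [expGL]) hg
  exact theMat_eq h fun D' hD' => ip_left_injective fun X => (hD' X).unique (h X)

theorem ip_frakK_projB {X : Mat n n} (hX : X ∈ frakK n) (Y : Mat n n) :
    ip X (projB n Y) = ip Y X := by
  conv_rhs => rw [ip_comm, ← projK_add_projB Y, ip_add_right, ip_frakK hX (projK_mem Y), zero_add]

/-- The derivative along `𝔨` is represented in `𝔟` by the `𝔟`-component of the derivative along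
`gl(n, ℂ)`, since `𝔨` is isotropic. -/
theorem theMat_isLeftDerivU (hU : IsOpen U) (hf : ContDiffOn ℝ ∞ f U) {F : Un n → ℝ}
    (hF : ∀ y : Un n, (y : Mat n n) ∈ U → F y = f y) {k : Un n} (hk : (k : Mat n n) ∈ U) :
    theMat (IsLeftDerivU F k) =
      projB n (sharp ((fderiv ℝ f k : Mat n n →ₗ[ℝ] ℝ) ∘ₗ infLeft (k : Mat n n))) := by
  have h : IsLeftDerivU F k
      (projB n (sharp ((fderiv ℝ f k : Mat n n →ₗ[ℝ] ℝ) ∘ₗ infLeft (k : Mat n n)))) := by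
    refine ⟨projB_mem _, fun X => ?_⟩
    rw [ip_frakK_projB X.2, ip_sharp]
    exact hasDerivAt_of_path (ι := fun g : Un n => (g : Mat n n)) hU hf hF
      (hasDerivAt_exp_mul (X : Mat n n) k) (by simp [expU]) hk
  exact theMat_eq h fun D' hD' => eq_of_mem_frakB hD'.1 h.1 fun X hX =>
    (hD'.2 ⟨X, hX⟩).unique (h.2 ⟨X, hX⟩)

theorem theMat_isRightDerivU (hU : IsOpen U) (hf : ContDiffOn ℝ ∞ f U) {F : Un n → ℝ}
    (hF : ∀ y : Un n, (y : Mat n n) ∈ U → F y = f y) {k : Un n} (hk : (k : Mat n n) ∈ U) :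
    theMat (IsRightDerivU F k) = projB n (sharp ((fderiv ℝ f k : Mat n n →ₗ[ℝ] ℝ) ∘ₗ
      mulLeftLinearMap (Fin n) ℝ (k : Mat n n))) := by
  have h : IsRightDerivU F k (projB n (sharp ((fderiv ℝ f k : Mat n n →ₗ[ℝ] ℝ) ∘ₗ
      mulLeftLinearMap (Fin n) ℝ (k : Mat n n)))) := by
    refine ⟨projB_mem _, fun X => ?_⟩
    rw [ip_frakK_projB X.2, ip_sharp]
    exact hasDerivAt_of_path (ι := fun g : Un n => (g : Mat n n)) hU hf hF
      (hasDerivAt_mul_exp (X : Mat n n) k) (by simp [expU]) hk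
  exact theMat_eq h fun D' hD' => eq_of_mem_frakB hD'.1 h.1 fun X hX =>
    (hD'.2 ⟨X, hX⟩).unique (h.2 ⟨X, hX⟩)

/-- The bivector `R_M - ρ_M` on square matrices in terms of left and right derivatives. -/
theorem matField_sklyanin (A : Mat n n) (α β : Module.Dual ℝ (Mat n n)) :
    α (matField n n (-1) 0 A β) =
      ip (sharp (α ∘ₗ infLeft A)) (rMat n (sharp (β ∘ₗ infLeft A))) -
      ip (sharp (α ∘ₗ mulLeftLinearMap (Fin n) ℝ A))
        (rMat n (sharp (β ∘ₗ mulLeftLinearMap (Fin n) ℝ A))) := by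
  have h : infRight A = -mulLeftLinearMap (Fin n) ℝ A := rfl
  have h' := pushTensor_neg (rMat n) (mulLeftLinearMap (Fin n) ℝ A) α β
  rw [← h] at h'
  rw [← bivector_eq_matField]
  simp only [Pi.add_apply, Pi.sub_apply, Pi.smul_apply, smul_eq_mul, mul_zero, zero_mul, sub_zero,
    neg_mul, one_mul, ← sub_eq_add_neg]
  exact congrArg (_ - ·) h'

theorem isInducedBracket_sklyanin (n : ℕ) :
    IsInducedBracket (Units.coeHom (Mat n n)) (fun v => (1 : ℝ) • matField n n (-1) 0 v)
      (sklyaninBracket n) := by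
  intro U f h F H hU hf hh hF hH g hg
  simp only [one_smul]
  rw [sklyaninBracket, theMat_isLeftDerivGL hU hf hF hg, theMat_isLeftDerivGL hU hh hH hg,
    theMat_isRightDerivGL hU hf hF hg, theMat_isRightDerivGL hU hh hH hg]
  exact (matField_sklyanin (g : Mat n n) (fderiv ℝ f g : Mat n n →ₗ[ℝ] ℝ)
    (fderiv ℝ h g : Mat n n →ₗ[ℝ] ℝ)).symm

theorem ip_conj_left {A B : Mat n n} (X Y : Mat n n) : ip (A * X * B) Y = ip X (B * Y * A) := by
  rw [ip, ip, Matrix.mul_assoc A, Matrix.mul_assoc A, Matrix.trace_mul_comm]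
  simp only [Matrix.mul_assoc]

/-- The left derivative is conjugate to the right derivative. -/
theorem sharp_comp_infLeft {A B : Mat n n} (hAB : A * B = 1) (α : Module.Dual ℝ (Mat n n)) :
    sharp (α ∘ₗ infLeft A) = A * sharp (α ∘ₗ mulLeftLinearMap (Fin n) ℝ A) * B :=
  sharp_eq fun X => by
    rw [ip_conj_left, ip_sharp]
    change α (X * A) = α (A * (B * X * A))
    rw [Matrix.mul_assoc B, ← Matrix.mul_assoc A, hAB, Matrix.one_mul]

/-- For conjugation by an element of the unitary group, this compares the two expressions for the
bracket: Lu–Weinstein on the left, Sklyanin on the right. -/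
theorem two_mul_ip_projB_conj {A B : Mat n n} (hBA : B * A = 1)
    (hk : ∀ X ∈ frakK n, A * X * B ∈ frakK n) (X Y : Mat n n) :
    2 * ip (projB n (A * X * B)) (A * projB n Y * B) =
      ip (A * X * B) (rMat n (A * Y * B)) - ip X (rMat n Y) := by
  have h₁ : A * projB n Y * B = A * Y * B - A * projK n Y * B := by
    conv_rhs => rw [← Matrix.sub_mul, ← Matrix.mul_sub]
    rw [← eq_sub_of_add_eq' (projK_add_projB Y)]
  have h₂ : ip (projB n (A * X * B)) (A * projK n Y * B) = ip X (projK n Y) := by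
    rw [ip_comm, ip_frakK_projB (hk _ (projK_mem Y)), ip_conj_left]
    simp only [← Matrix.mul_assoc]
    rw [hBA, Matrix.one_mul, Matrix.mul_assoc, hBA, Matrix.mul_one]
  have h₃ : ip (A * X * B) (A * Y * B) = ip X Y := by
    rw [ip_conj_left]
    simp only [← Matrix.mul_assoc]
    rw [hBA, Matrix.one_mul, Matrix.mul_assoc, hBA, Matrix.mul_one]
  have h₄ : projK n (A * X * B) = A * X * B - projB n (A * X * B) :=
    eq_sub_of_add_eq (projK_add_projB _)
  have h₅ : projB n Y = Y - projK n Y := eq_sub_of_add_eq' (projK_add_projB _)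
  rw [h₁, ip_sub_right, h₂, ip_rMat, rMat_apply, h₄, rMat_apply, h₅]
  simp only [ip_sub_left, ip_sub_right, h₃]
  ring

theorem conj_mem_frakK (k : Un n) {X : Mat n n} (hX : X ∈ frakK n) :
    (k : Mat n n) * X * ((k⁻¹ : Un n) : Mat n n) ∈ frakK n := by
  change _ + _ᴴ = _
  have h : ((k⁻¹ : Un n) : Mat n n) = (k : Mat n n)ᴴ := rfl
  rw [h, Matrix.conjTranspose_mul, Matrix.conjTranspose_mul, Matrix.conjTranspose_conjTranspose,
    conjTranspose_of_mem_frakK hX]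
  simp [Matrix.mul_assoc]

/-- The Lu–Weinstein bracket is one half of the restriction of the Sklyanin bracket to `U(n)`. -/
theorem isInducedBracket_luWeinstein (n : ℕ) :
    IsInducedBracket (Matrix.unitaryGroup (Fin n) ℂ).subtype
      (fun v => (1 / 2 : ℝ) • matField n n (-1) 0 v) (luWeinsteinBracket n) := by
  intro U f h F H hU hf hh hF hH k hk
  have hkk : (k : Mat n n) * ((k⁻¹ : Un n) : Mat n n) = 1 :=
    congrArg Subtype.val (mul_inv_cancel k)
  have h₁ := matField_sklyanin (k : Mat n n) (fderiv ℝ f k : Mat n n →ₗ[ℝ] ℝ)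
    (fderiv ℝ h k : Mat n n →ₗ[ℝ] ℝ)
  rw [luWeinsteinBracket, theMat_isLeftDerivU hU hf hF hk, theMat_isRightDerivU hU hh hH hk,
    sharp_comp_infLeft hkk]
  rw [sharp_comp_infLeft hkk, sharp_comp_infLeft hkk,
    ← two_mul_ip_projB_conj (mul_eq_one_comm.1 hkk) fun X hX => conj_mem_frakK k hX] at h₁
  refine (Eq.trans ?_ (congrArg ((1 / 2 : ℝ) * ·) h₁.symm)).trans ?_
  · simp
  · simp only [fieldBracket, LinearMap.smul_apply, map_smul, smul_eq_mul]
    rfl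

theorem isInducedBracket_two_smul_luWeinstein (n : ℕ) :
    IsInducedBracket (Matrix.unitaryGroup (Fin n) ℂ).subtype
      (fun v => (1 : ℝ) • matField n n (-1) 0 v)
      fun F H => (2 : ℝ) • luWeinsteinBracket n F H := by
  simpa [smul_smul] using (isInducedBracket_luWeinstein n).const_smul 2

theorem isInducedBracket_half_smul_sklyanin (n : ℕ) :
    IsInducedBracket (Units.coeHom (Mat n n)) (fun v => (1 / 2 : ℝ) • matField n n (-1) 0 v)
      fun F H => (1 / 2 : ℝ) • sklyaninBracket n F H := by
  simpa only [smul_smul, mul_one] using (isInducedBracket_sklyanin n).const_smul (1 / 2)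

end Derivatives

/-! ### Linear functions -/

section LinearFunctions

variable {n d : ℕ}

/-- The Hamiltonian vector field of a linear function for `½ P_λ`, by `R = 2 P_𝔨 - 1`. -/
theorem half_smul_matField_cov (lam : ℝ) (v ξ : Mat n d) :
    ((1 / 2 : ℝ) • matField n d 1 lam v) (cov n d ξ) =
      projK n (v * ξᴴ) * v + v * projK d (ξᴴ * v) - v * ξᴴ * v - (lam : ℂ) • ξ := by
  have h : (lam : ℂ) • ξ = lam • ξ := Complex.coe_smul lam ξ
  rw [LinearMap.smul_apply, matField_cov, rMat_eq_two_smul, rMat_eq_two_smul, h]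
  simp only [Matrix.sub_mul, Matrix.mul_sub, Matrix.smul_mul, Matrix.mul_smul, Matrix.mul_assoc]
  module

theorem fderiv_cov (ξ v : Mat n d) :
    (fderiv ℝ (cov n d ξ) v : Mat n d →ₗ[ℝ] ℝ) = cov n d ξ :=
  LinearMap.ext fun x => congrArg (fun α : Mat n d →L[ℝ] ℝ => α x)
    (LinearMap.toContinuousLinearMap (cov n d ξ)).fderiv

theorem bracketM_cov_right (lam : ℝ) (ξ : Mat n d) (H : Mat n d → ℝ) (v : Mat n d) :
    bracketM n d lam H (cov n d ξ) v = fderiv ℝ H v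
      (projK n (v * ξᴴ) * v + v * projK d (ξᴴ * v) - v * ξᴴ * v - (lam : ℂ) • ξ) := by
  rw [bracketM, bivBracket, fderiv_cov, smul_bivP_apply, half_smul_matField_cov]
  rfl

theorem isHamiltonianVectorField_cov (lam : ℝ) (ξ : Mat n d) :
    IsHamiltonianVectorField (bracketM n d lam) (cov n d ξ) fun v =>
      projK n (v * ξᴴ) * v + v * projK d (ξᴴ * v) - v * ξᴴ * v - (lam : ℂ) • ξ :=
  fun H _ v => (bracketM_cov_right lam ξ H v).symm

theorem bracketM_cov_cov (lam : ℝ) (ξ η v : Mat n d) :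
    bracketM n d lam (cov n d ξ) (cov n d η) v =
      (v * ξᴴ * projK n (v * ηᴴ)).trace.im +
        (ξᴴ * v * projK d (ηᴴ * v) - ξᴴ * v * ηᴴ * v - (lam : ℂ) • (ξᴴ * η)).trace.im := by
  have hc : (v * ξᴴ * projK n (v * ηᴴ)).trace = (ξᴴ * (projK n (v * ηᴴ) * v)).trace := by
    rw [Matrix.mul_assoc, Matrix.trace_mul_comm, Matrix.mul_assoc]
  rw [bracketM_cov_right, hc]
  refine (DFunLike.congr_fun (fderiv_cov ξ v) _).trans ?_
  rw [cov_apply]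
  simp only [Matrix.mul_add, Matrix.mul_sub, Matrix.mul_smul, Matrix.mul_assoc, Matrix.trace_add,
    Matrix.trace_sub, Complex.add_im, Complex.sub_im]
  ring

end LinearFunctions

end RealZakrzewski

theorem proposition4 (n d : ℕ) :
    (∀ lam : ℝ,
      -- `P_λ` is a Poisson tensor, and so is one half of it
      IsPoissonTensor (bivP n d lam) ∧
      IsPoissonBracket (smoothMat n d) (bracketM n d lam) ∧
      -- the bracket of two linear functions
      (∀ (ξ η v : Mat n d), bracketM n d lam (cov n d ξ) (cov n d η) v =
        (v * ξᴴ * projK n (v * ηᴴ)).trace.im +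
          (ξᴴ * v * projK d (ηᴴ * v) - ξᴴ * v * ηᴴ * v - (lam : ℂ) • (ξᴴ * η)).trace.im) ∧
      -- the Hamiltonian vector field of a linear function
      (∀ ξ : Mat n d, IsHamiltonianVectorField (bracketM n d lam) (cov n d ξ) (fun v =>
        projK n (v * ξᴴ) * v + v * projK d (ξᴴ * v) - v * ξᴴ * v - (lam : ℂ) • ξ)) ∧
      -- the actions of `U(n)` and `U(d)` are Poisson actions for the Lu–Weinstein brackets
      IsPoissonAction (smoothU n) (luWeinsteinBracket n)
        (smoothMat n d) (bracketM n d lam) (actLeftU n d) ∧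
      IsPoissonAction (smoothU d) (luWeinsteinBracket d)
        (smoothMat n d) (bracketM n d lam) (actRightU n d) ∧
      -- the same for `P_λ` itself, with the correspondingly normalized brackets
      IsPoissonAction (smoothU n) (fun F H => (2 : ℝ) • luWeinsteinBracket n F H)
        (smoothMat n d) (bivBracket (bivP n d lam)) (actLeftU n d) ∧
      IsPoissonAction (smoothU d) (fun F H => (2 : ℝ) • luWeinsteinBracket d F H)
        (smoothMat n d) (bivBracket (bivP n d lam)) (actRightU n d)) ∧
    -- for `λ = 0`, the actions of `GL(n, ℂ)` and `GL(d, ℂ)` are Poisson actions for the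
    -- Sklyanin brackets (with `P_0`), or one half of them (with one half of `P_0`)
    IsPoissonAction (smoothGL n) (sklyaninBracket n)
      (smoothMat n d) (bivBracket (bivP n d 0)) (actLeftGL n d) ∧
    IsPoissonAction (smoothGL d) (sklyaninBracket d)
      (smoothMat n d) (bivBracket (bivP n d 0)) (actRightGL n d) ∧
    IsPoissonAction (smoothGL n) (fun F H => (1 / 2 : ℝ) • sklyaninBracket n F H)
      (smoothMat n d) (bracketM n d 0) (actLeftGL n d) ∧
    IsPoissonAction (smoothGL d) (fun F H => (1 / 2 : ℝ) • sklyaninBracket d F H)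
      (smoothMat n d) (bracketM n d 0) (actRightGL n d) := by
  have hunit : ∀ m (k : Un m), (k : Mat m m) * (k : Mat m m)ᴴ = 1 := fun m k =>
    Matrix.mem_unitaryGroup_iff.1 k.2
  have h1 : ∀ lam, bivP n d lam = (1 : ℝ) • bivP n d lam := fun lam => (one_smul ℝ _).symm
  refine ⟨fun lam => ⟨?_, isPoissonBracket_bivP n d (1 / 2) lam, bracketM_cov_cov lam,
    isHamiltonianVectorField_cov lam,
    isPoissonAction_left (isInducedBracket_luWeinstein n) (Or.inr (hunit n)),
    isPoissonAction_right (isInducedBracket_luWeinstein d) (Or.inr (hunit d)), ?_, ?_⟩, ?_, ?_,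
    isPoissonAction_left (isInducedBracket_half_smul_sklyanin n) (Or.inl rfl),
    isPoissonAction_right (isInducedBracket_half_smul_sklyanin d) (Or.inl rfl)⟩
  · rw [h1]
    exact isPoissonBracket_bivP n d 1 lam
  · rw [h1]
    exact isPoissonAction_left (isInducedBracket_two_smul_luWeinstein n) (Or.inr (hunit n))
  · rw [h1]
    exact isPoissonAction_right (isInducedBracket_two_smul_luWeinstein d) (Or.inr (hunit d))
  · rw [h1]
    exact isPoissonAction_left (isInducedBracket_sklyanin n) (Or.inl rfl)
  · rw [h1]
    exact isPoissonAction_right (isInducedBracket_sklyanin d) (Or.inl rfl)
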